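/- Let $\{\lambda_n\}_{n\ge 0}$ be nonnegative numbers with $\sum_{n\ge0}\lambda_n=1$ and $\sup_{n\ge 0}\gamma^{-n}\lambda_n<\infty$ for some $\gamma\in(0,1)$. Let $\{\xi_n\}_{n\ge1}$ be i.i.d. nonnegative random variables whose Laplace transform $\phi(t)=\mathbb E(e^{-t\xi_1})$ satisfies $$1-t^{\alpha}\le \phi(t)\le c(1+t)^{-\beta},\qquad t\ge 0,$$ for some constants $0<\alpha\le 1$, $\beta>0$, $c>0$. Let $\omega_0>0$ be a constant and $$\omega_n=\Big(1-\sum_{k=1}^n\lambda_{n-k}\Big)\omega_0+\sum_{k=1}^n\lambda_{n-k}\xi_k,\qquad n\ge 1.$$ Let $F$ be a function with $0\le F(s)<\infty$ for $s>0$ that is the Laplace transform of a nonnegative function $f$ on $(0,\infty)$ of at most polynomial growth at infinity: $F(s)=\int_0^\infty e^{-st}f(t)\,dt$ for $s>0$, and $f(t)\le C(1+t)^m$ for $t\ge 1$, for some constants $C>0$, $m\ge0$. Let $(f*f)(t)=\int_0^t f(s)f(t-s)\,ds$ and $$V=\int_0^\infty (f*f)(t)\prod_{k=0}^\infty\phi(\lambda_k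 t)\,dt .$$ If only finitely many of the $\lambda_n$ are nonzero, assume in addition that $V<\infty$. Let $\{\eta_n\}_{n\ge1}$ be random variables such that, for every $n\ge 0$, $\eta_{n+1}$ is independent of $\{(\xi_k,\eta_k):1\le k\le n\}$, and such that $\mathbb E(\eta_n)=0$ for all $n\ge 1$, $\lim_{n\to\infty}\mathbb E(\eta_n^2)=1$, and $\sup_{n\ge1}\mathbb E(|\eta_n|^p)<\infty$ for some $p>2$. Then $V<\infty$ and $$\frac1{\sqrt N}\sum_{k=1}^N F(\omega_{k-1})\,\eta_k\longrightarrow \mathcal N(0,V)\quad\text{in distribution as }N\to\infty,$$ where $\mathcal N(0,V)$ is the normal distribution with mean $0$ and variance $V$ (the point mass at $0$ if $V=0$). -/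

import Mathlib

open MeasureTheory ProbabilityTheory Filter Topology

noncomputable section

/-- The Laplace transform `t ↦ 𝔼[exp (-t X)]` of a real random variable `X`. -/
def rvLaplace {Ω : Type*} [MeasurableSpace Ω] (P : Measure Ω) (X : Ω → ℝ) (t : ℝ) : ℝ :=
  ∫ w, Real.exp (-t * X w) ∂P

/-- The Laplace transform `s ↦ ∫₀^∞ exp (-s t) f(t) dt` of a function `f` on `(0, ∞)`. -/
def laplaceTransform (f : ℝ → ℝ) (s : ℝ) : ℝ :=
  ∫ t in Set.Ioi (0 : ℝ), Real.exp (-s * t) * f t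

/-- `F` is, on `(0, ∞)`, a finite nonnegative function which is the Laplace transform of a
nonnegative function `f` on `(0, ∞)` with at most polynomial growth at infinity. The field
`integrable` says that the integral defining the Laplace transform converges at every `s > 0`. -/
structure IsPolyLaplace (F f : ℝ → ℝ) : Prop where
  nonneg_left : ∀ s : ℝ, 0 < s → 0 ≤ F s
  nonneg_right : ∀ t : ℝ, 0 < t → 0 ≤ f t
  integrable : ∀ s : ℝ, 0 < s →
    IntegrableOn (fun t : ℝ => Real.exp (-s * t) * f t) (Set.Ioi 0)
  eq_laplace : ∀ s : ℝ, 0 < s → F s = laplaceTransform f s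
  growth : ∃ c : ℝ, 0 < c ∧ ∃ m : ℝ, 0 ≤ m ∧ ∀ t : ℝ, 1 ≤ t → f t ≤ c * (1 + t) ^ m

/-- The self-convolution `(f ∗ f)(t) = ∫₀ᵗ f(s) f(t - s) ds` of a function on `(0, ∞)`. -/
def selfConv (f : ℝ → ℝ) (t : ℝ) : ℝ := ∫ s in (0 : ℝ)..t, f s * f (t - s)

/-- The moving average
`ω_n = (1 - ∑_{k=1}^n λ_{n-k}) ω₀ + ∑_{k=1}^n λ_{n-k} ξ_k`; for `n = 0` this is `ω₀`. -/
def movingAverage {Ω : Type*} (lam : ℕ → ℝ) (ω₀ : ℝ) (ξ : ℕ → Ω → ℝ) (n : ℕ) (w : Ω) : ℝ :=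
  (1 - ∑ k ∈ Finset.Icc 1 n, lam (n - k)) * ω₀ + ∑ k ∈ Finset.Icc 1 n, lam (n - k) * ξ k w

/-- The integrand `(f ∗ f)(t) ∏_{k ≥ 0} φ(λ_k t)` of the limiting variance. -/
def varianceIntegrand (f φ : ℝ → ℝ) (lam : ℕ → ℝ) (t : ℝ) : ℝ :=
  selfConv f t * ∏' k : ℕ, φ (lam k * t)

/-- The limiting variance `∫₀^∞ (f ∗ f)(t) ∏_{k ≥ 0} φ(λ_k t) dt`. -/
def limitVariance (f φ : ℝ → ℝ) (lam : ℕ → ℝ) : ℝ :=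
  ∫ t in Set.Ioi (0 : ℝ), varianceIntegrand f φ lam t

end

/-! Put X_i = F(ω_i) and e_i = η_{i+1}. Given the past, X_i is known and e_i is centred with
variance close to 1, so the sum is a martingale with normalised conditional variance N⁻¹ ∑ X_i²
𝔼e_i². A Gaussian limit follows once this average converges to a constant.

The constant is V because F² is the Laplace transform of f∗f: 𝔼F(ω_n)² = ∫ (f∗f)(t) 𝔼e^{-tω_n} dt,
and by independence 𝔼e^{-tω_n} is a product tending to ∏ φ(λ_k t)
(`IsLaplaceNoise.rvLaplace_movingAverage`). Domination comes from the upper bound on φ: with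
infinitely many positive weights, arbitrarily many factors decay like t^{-β} and beat the polynomial
growth of f; with finitely many, the product is eventually exact and V < ∞ is assumed
(`IsLaplaceNoise.exists_integrableOn_bound`).

Since F may blow up at 0, it is first replaced by the bounded function F(· + ε). For bounded
weights, `norm_integral_exp_compensated_sub_one_le` telescopes the characteristic function
multiplied by the exponential of the conditional variance, and
`tendsto_integral_exp_sum_mul_innovation` concludes from a weak law. The weak law rests on decay of
covariances (`IsLaplaceNoise.exists_covariance_le`): ω_{i+m} is a part independent of ω_i plus a
remote part r, and 𝔼(1 - e^{-r}) is small by the lower bound on φ.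

Finally ε → 0. Orthogonality of the increments and (F(x) - F(x+ε))² ≤ F(x)² - F(x+ε)² bound the
squared L² error by a Cesàro mean tending to V - V_ε, where V_ε is the variance for F(· + ε); and
V_ε → V. -/

/-! ### Exponential bounds and one-step characteristic function estimates. -/

/-- For |x| ≤ 1 the cubic Taylor remainder is absorbed because q ≤ 3; for |x| > 1 every term is at
most quadratic and q ≥ 2. Allowing q < 3 means that only a moment slightly above the second is
needed. -/
theorem norm_exp_I_sub_quadratic_le {q : ℝ} (hq2 : 2 ≤ q) (hq3 : q ≤ 3) (x : ℝ) :
    ‖Complex.exp (x * Complex.I) - (1 + x * Complex.I - x ^ 2 / 2)‖ ≤ 4 * |x| ^ q := by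
  rcases le_or_gt |x| 1 with h | h
  · have hn : ‖(x : ℂ) * Complex.I‖ = |x| := by simp
    have h1 := Complex.exp_bound (x := x * Complex.I) (by rw [hn]; exact h) (n := 3) (by norm_num)
    rw [hn] at h1
    have h2 : ∑ m ∈ Finset.range 3, ((x : ℂ) * Complex.I) ^ m / (m.factorial : ℂ)
        = 1 + x * Complex.I - x ^ 2 / 2 := by
      simp only [Finset.sum_range_succ, Finset.sum_range_zero, mul_pow, Complex.I_sq]
      simp
      ring
    rw [h2] at h1
    have h3 : |x| ^ (3 : ℕ) ≤ |x| ^ q := by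
      rw [← Real.rpow_natCast]
      rcases (abs_nonneg x).eq_or_lt with h0 | h0
      · rw [← h0, Real.zero_rpow (by norm_num), Real.zero_rpow (by linarith)]
      · exact Real.rpow_le_rpow_of_exponent_ge h0 h (by simpa using hq3)
    refine h1.trans ?_
    have h4 : ((Nat.succ 3 : ℕ) : ℝ) * (((Nat.factorial 3 : ℕ) : ℝ) * ((3 : ℕ) : ℝ))⁻¹ ≤ 4 := by
      norm_num [Nat.factorial]
    have h5 : 0 ≤ |x| ^ q := by positivity
    calc |x| ^ 3 * (((Nat.succ 3 : ℕ) : ℝ) * (((Nat.factorial 3 : ℕ) : ℝ) * ((3 : ℕ) : ℝ))⁻¹)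
        ≤ |x| ^ q * 4 := mul_le_mul h3 h4 (by positivity) h5
      _ = _ := by ring
  · have h3 : |x| ^ (2 : ℕ) ≤ |x| ^ q := by
      rw [← Real.rpow_natCast]
      exact Real.rpow_le_rpow_of_exponent_le h.le (by simpa using hq2)
    have h1 : ‖Complex.exp (x * Complex.I)‖ = 1 := Complex.norm_exp_ofReal_mul_I x
    have h2 : ‖(1 + x * Complex.I - x ^ 2 / 2 : ℂ)‖ ≤ 1 + |x| + |x| ^ 2 / 2 := by
      refine (norm_sub_le _ _).trans (add_le_add ((norm_add_le _ _).trans ?_) ?_) <;> simp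
    refine (norm_sub_le _ _).trans ?_
    nlinarith

theorem abs_exp_neg_sub_linear_le {y : ℝ} (hy : 0 ≤ y) : |Real.exp (-y) - (1 - y)| ≤ y ^ 2 := by
  rcases le_or_gt y 1 with h | h
  · have := Real.abs_exp_sub_one_sub_id_le (x := -y) (by rwa [abs_neg, abs_of_nonneg hy])
    rw [neg_sq] at this
    convert this using 2
    ring
  · have h1 := Real.exp_pos (-y)
    have h2 : Real.exp (-y) ≤ 1 := Real.exp_le_one_iff.2 (by linarith)
    rw [abs_le]
    constructor <;> nlinarith

section charfun

variable {Ω : Type*} [mΩ : MeasurableSpace Ω] {P : Measure Ω} [IsProbabilityMeasure P]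

/-- Second order expansion of the characteristic function of a centred random variable,
compared with the Gaussian of the same variance. -/
theorem norm_integral_exp_sub_gaussian_le {e : Ω → ℝ} (he : Measurable e) {q M : ℝ}
    (hq2 : 2 ≤ q) (hq3 : q ≤ 3) (h2 : MemLp e 2 P) (hmean : ∫ w, e w ∂P = 0)
    (hint : Integrable (fun w => |e w| ^ q) P) (hM : ∫ w, |e w| ^ q ∂P ≤ M) (s : ℝ) :
    ‖∫ w, Complex.exp ((s * e w : ℝ) * Complex.I) ∂P
        - (Real.exp (-(s ^ 2 * (∫ w, e w ^ 2 ∂P) / 2)) : ℝ)‖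
      ≤ 4 * |s| ^ q * M + (s ^ 2 * (∫ w, e w ^ 2 ∂P) / 2) ^ 2 := by
  set v := ∫ w, e w ^ 2 ∂P with hv
  have hv0 : 0 ≤ v := integral_nonneg fun w => sq_nonneg _
  have i1 : Integrable e P := h2.integrable (by norm_num)
  have i2 : Integrable (fun w => e w ^ 2) P := h2.integrable_sq
  have ic1 : Integrable (fun w => ((s * e w : ℝ) : ℂ) * Complex.I) P :=
    ((i1.const_mul s).ofReal).mul_const _
  have ic2 : Integrable (fun w => ((s * e w : ℝ) : ℂ) ^ 2 / 2) P := by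
    have := ((i2.const_mul (s ^ 2 / 2)).ofReal (𝕜 := ℂ))
    refine this.congr (ae_of_all _ fun w => ?_)
    simp only [RCLike.ofReal_eq_complex_ofReal]
    push_cast
    ring
  have iq : Integrable (fun w => 1 + ((s * e w : ℝ) : ℂ) * Complex.I
      - ((s * e w : ℝ) : ℂ) ^ 2 / 2) P := ((integrable_const 1).add ic1).sub ic2
  have ie : Integrable (fun w => Complex.exp ((s * e w : ℝ) * Complex.I)) P := by
    refine Integrable.of_bound (by fun_prop) 1 (ae_of_all _ fun w => ?_)
    rw [Complex.norm_exp_ofReal_mul_I]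
  have e1 : ∫ w, (1 + ((s * e w : ℝ) : ℂ) * Complex.I - ((s * e w : ℝ) : ℂ) ^ 2 / 2) ∂P
      = ((1 - s ^ 2 * v / 2 : ℝ) : ℂ) := by
    rw [integral_sub (f := fun w => 1 + ((s * e w : ℝ) : ℂ) * Complex.I)
        ((integrable_const 1).add ic1) ic2, integral_add (integrable_const 1) ic1,
      integral_mul_const, integral_complex_ofReal, integral_const_mul, hmean]
    have : ∫ w, ((s * e w : ℝ) : ℂ) ^ 2 / 2 ∂P = ((s ^ 2 / 2 * v : ℝ) : ℂ) := by
      rw [hv, ← integral_const_mul, ← integral_complex_ofReal]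
      congr 1 with w
      push_cast
      ring
    rw [this]
    simp
    ring
  have b1 : ‖∫ w, Complex.exp ((s * e w : ℝ) * Complex.I) ∂P - ((1 - s ^ 2 * v / 2 : ℝ) : ℂ)‖
      ≤ 4 * |s| ^ q * M := by
    rw [← e1, ← integral_sub ie iq]
    calc _ ≤ ∫ w, 4 * |s| ^ q * |e w| ^ q ∂P := by
          refine norm_integral_le_of_norm_le (hint.const_mul _) (ae_of_all _ fun w => ?_)
          refine (norm_exp_I_sub_quadratic_le hq2 hq3 _).trans (le_of_eq ?_)
          rw [abs_mul, Real.mul_rpow (abs_nonneg _) (abs_nonneg _), mul_assoc]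
      _ ≤ _ := by
          rw [integral_const_mul]
          gcongr
  have b2 := abs_exp_neg_sub_linear_le (y := s ^ 2 * v / 2) (by positivity)
  have b2' : ‖((1 - s ^ 2 * v / 2 : ℝ) : ℂ) - ((Real.exp (-(s ^ 2 * v / 2)) : ℝ) : ℂ)‖
      ≤ (s ^ 2 * v / 2) ^ 2 := by
    rw [← Complex.ofReal_sub, Complex.norm_real, Real.norm_eq_abs, abs_sub_comm]
    exact b2
  refine (norm_sub_le_norm_sub_add_norm_sub _ ((1 - s ^ 2 * v / 2 : ℝ) : ℂ) _).trans ?_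
  exact add_le_add b1 b2'

/-- Fubini for the joint law, which is a product by independence. It takes the place of conditioning
on Y. -/
theorem ProbabilityTheory.IndepFun.integral_comp_eq_integral_integral {α β : Type*}
    [MeasurableSpace α] [MeasurableSpace β] {Y : Ω → α} {e : Ω → β} (h : IndepFun Y e P)
    (hY : Measurable Y) (he : Measurable e) {g : α × β → ℂ} (hg : Measurable g)
    (hint : Integrable (fun w => g (Y w, e w)) P) :
    ∫ w, g (Y w, e w) ∂P = ∫ w, (∫ w', g (Y w, e w') ∂P) ∂P := by
  have hmap := (indepFun_iff_map_prod_eq_prod_map_map hY.aemeasurable he.aemeasurable).1 h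
  have : IsProbabilityMeasure (P.map Y) := Measure.isProbabilityMeasure_map hY.aemeasurable
  have : IsProbabilityMeasure (P.map e) := Measure.isProbabilityMeasure_map he.aemeasurable
  have hi : Integrable g ((P.map Y).prod (P.map e)) := by
    rw [← hmap]
    exact (integrable_map_measure hg.aestronglyMeasurable (by fun_prop)).2 hint
  calc ∫ w, g (Y w, e w) ∂P = ∫ z, g z ∂(P.map fun w => (Y w, e w)) :=
        (integral_map (by fun_prop) hg.aestronglyMeasurable).symm
    _ = ∫ y, ∫ x, g (y, x) ∂(P.map e) ∂(P.map Y) := by rw [hmap, integral_prod _ hi]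
    _ = ∫ w, ∫ x, g (Y w, x) ∂(P.map e) ∂P :=
        integral_map hY.aemeasurable hi.integral_prod_left.aestronglyMeasurable
    _ = _ := by
        congr 1 with w
        exact integral_map (f := fun x => g (Y w, x)) he.aemeasurable
          (hg.comp measurable_prodMk_left).aestronglyMeasurable

/-- One step of the telescoping argument: replacing `exp (i s X e)` by its conditional Gaussian
approximation. -/
theorem norm_integral_mul_exp_sub_gaussian_le {Z : Ω → ℂ} {X e : Ω → ℝ}
    (hZ : Measurable Z) (hX : Measurable X) (he : Measurable e)
    (hind : IndepFun (fun w => (Z w, X w)) e P)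
    {q M A K v₀ : ℝ} (hq2 : 2 ≤ q) (hq3 : q ≤ 3) (h2 : MemLp e 2 P) (hmean : ∫ w, e w ∂P = 0)
    (hint : Integrable (fun w => |e w| ^ q) P) (hM : ∫ w, |e w| ^ q ∂P ≤ M)
    (hv : ∫ w, e w ^ 2 ∂P ≤ v₀)
    (hA : ∀ w, ‖Z w‖ ≤ A) (hK : ∀ w, |X w| ≤ K) (s : ℝ) :
    ‖∫ w, Z w * (Complex.exp ((s * X w * e w : ℝ) * Complex.I)
        - (Real.exp (-((s * X w) ^ 2 * (∫ w, e w ^ 2 ∂P) / 2)) : ℝ)) ∂P‖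
      ≤ A * (4 * (|s| * K) ^ q * M + ((|s| * K) ^ 2 * v₀ / 2) ^ 2) := by
  set v := ∫ w, e w ^ 2 ∂P with hvdef
  have hv0 : 0 ≤ v := integral_nonneg fun w => sq_nonneg _
  have hM0 : 0 ≤ M := le_trans (integral_nonneg fun w => by positivity) hM
  let g : (ℂ × ℝ) × ℝ → ℂ := fun z => z.1.1 * (Complex.exp ((s * z.1.2 * z.2 : ℝ) * Complex.I)
        - (Real.exp (-((s * z.1.2) ^ 2 * v / 2)) : ℝ))
  have hg : Measurable g := by fun_prop
  have hexp : ∀ x : ℝ, ‖((Real.exp (-((s * x) ^ 2 * v / 2)) : ℝ) : ℂ)‖ ≤ 1 := fun x => by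
    rw [Complex.norm_real, Real.norm_eq_abs, abs_of_pos (Real.exp_pos _)]
    exact Real.exp_le_one_iff.2 (neg_nonpos.2 (by positivity))
  have hA0 : 0 ≤ A := by
    obtain ⟨w⟩ := P.nonempty_of_neZero
    exact (norm_nonneg _).trans (hA w)
  have hgi : Integrable (fun w => g ((Z w, X w), e w)) P := by
    refine Integrable.of_bound (by fun_prop) (A * 2) (ae_of_all _ fun w => ?_)
    rw [norm_mul]
    refine mul_le_mul (hA w) ?_ (norm_nonneg _) hA0
    refine (norm_sub_le _ _).trans ?_
    rw [Complex.norm_exp_ofReal_mul_I]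
    linarith [hexp (X w)]
  -- With (Z, X) frozen, the inner integral is the characteristic function of e at frequency s * X
  -- w, so the deterministic expansion applies for each w.
  have key := hind.integral_comp_eq_integral_integral (hZ.prodMk hX) he hg hgi
  change ‖∫ w, g ((Z w, X w), e w) ∂P‖ ≤ _
  rw [key]
  refine (norm_integral_le_of_norm_le_const (ae_of_all _ fun w => ?_)).trans
    (le_of_eq (by rw [probReal_univ, mul_one]))
  have hi1 : Integrable (fun w' => Complex.exp ((s * X w * e w' : ℝ) * Complex.I)) P := by
    refine Integrable.of_bound (by fun_prop) 1 (ae_of_all _ fun w => ?_)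
    rw [Complex.norm_exp_ofReal_mul_I]
  simp only [g]
  rw [integral_const_mul, norm_mul, integral_sub hi1 (integrable_const _), integral_const,
    probReal_univ, one_smul]
  refine mul_le_mul (hA w) ?_ (norm_nonneg _) hA0
  refine (norm_integral_exp_sub_gaussian_le he hq2 hq3 h2 hmean hint hM (s * X w)).trans ?_
  have h1 : |s * X w| ≤ |s| * K := by
    rw [abs_mul]
    exact mul_le_mul_of_nonneg_left (hK w) (abs_nonneg _)
  have h3 : (s * X w) ^ 2 ≤ (|s| * K) ^ 2 := by
    rw [← sq_abs (s * X w)]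
    gcongr
  gcongr

end charfun

theorem Real.abs_exp_sub_exp_le {a b R : ℝ} (ha : a ≤ R) (hb : b ≤ R) :
    |Real.exp a - Real.exp b| ≤ Real.exp R * |a - b| := by
  wlog h : a ≤ b generalizing a b
  · rw [abs_sub_comm, abs_sub_comm a b]
    exact this hb ha (le_of_not_ge h)
  rw [abs_sub_comm, abs_sub_comm a b, abs_of_nonneg (sub_nonneg.2 (Real.exp_le_exp.2 h)),
    abs_of_nonneg (sub_nonneg.2 h)]
  have h1 : Real.exp a = Real.exp b * Real.exp (a - b) := by rw [← Real.exp_add]; ring_nf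
  have h2 := Real.add_one_le_exp (a - b)
  have h3 : Real.exp b ≤ Real.exp R := Real.exp_le_exp.2 hb
  calc Real.exp b - Real.exp a = Real.exp b * (1 - Real.exp (a - b)) := by rw [h1]; ring
    _ ≤ Real.exp b * (b - a) := mul_le_mul_of_nonneg_left (by linarith) (Real.exp_pos b).le
    _ ≤ _ := mul_le_mul_of_nonneg_right h3 (by linarith)

/-! ### Central limit theorem for bounded predictable weights. -/

section martingale

variable {Ω : Type*} [mΩ : MeasurableSpace Ω] {P : Measure Ω}
  {𝓕 : Filtration ℕ mΩ} {X e : ℕ → Ω → ℝ}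

theorem measurable_sum_mul_innovation (hX : ∀ i, Measurable[𝓕 i] (X i))
    (he : ∀ i, Measurable[𝓕 (i + 1)] (e i)) (k : ℕ) :
    Measurable[𝓕 k] fun w => ∑ i ∈ Finset.range k, X i w * e i w := by
  refine Finset.measurable_fun_sum _ fun i hi => ?_
  have hik : i + 1 ≤ k := Finset.mem_range.1 hi
  exact ((hX i).mono (𝓕.mono (by omega)) le_rfl).mul ((he i).mono (𝓕.mono hik) le_rfl)

/-- Orthogonality of the increments `X_i e_i`. -/
theorem memLp_sum_mul_innovation (hX : ∀ i, Measurable[𝓕 i] (X i))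
    (he : ∀ i, Measurable[𝓕 (i + 1)] (e i))
    (hind : ∀ i, Indep (𝓕 i) (MeasurableSpace.comap (e i) inferInstance) P)
    (h2 : ∀ i, MemLp (e i) 2 P) (hmean : ∀ i, ∫ w, e i w ∂P = 0) (hX2 : ∀ i, MemLp (X i) 2 P)
    (N : ℕ) :
    MemLp (fun w => ∑ i ∈ Finset.range N, X i w * e i w) 2 P ∧
    ∫ w, (∑ i ∈ Finset.range N, X i w * e i w) ^ 2 ∂P
      = ∑ i ∈ Finset.range N, (∫ w, X i w ^ 2 ∂P) * ∫ w, e i w ^ 2 ∂P := by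
  have hX' : ∀ i, Measurable (X i) := fun i => (hX i).mono (𝓕.le i) le_rfl
  have he' : ∀ i, Measurable (e i) := fun i => (he i).mono (𝓕.le _) le_rfl
  have hindf : ∀ i (Y : Ω → ℝ), Measurable[𝓕 i] Y → IndepFun Y (e i) P := fun i Y hY => by
    rw [IndepFun_iff_Indep]
    exact indep_of_indep_of_le_left (hind i) hY.comap_le
  -- Independence makes second moments of the two factors sufficient. The weights need not be
  -- bounded, which matters for F(ω_i) itself.
  have hXe : ∀ i, MemLp (fun w => X i w * e i w) 2 P := fun i => by
    refine (memLp_two_iff_integrable_sq ((hX' i).mul (he' i)).aestronglyMeasurable).2 ?_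
    simp only [Pi.mul_apply]
    simp_rw [mul_pow]
    exact ((hindf i _ (hX i)).comp (φ := fun x => x ^ 2) (ψ := fun x => x ^ 2) (by fun_prop)
      (by fun_prop)).integrable_mul (hX2 i).integrable_sq (h2 i).integrable_sq
  have hS : ∀ N, MemLp (fun w => ∑ i ∈ Finset.range N, X i w * e i w) 2 P := fun N =>
    memLp_finsetSum _ fun i _ => hXe i
  refine ⟨hS N, ?_⟩
  induction N with
  | zero => simp
  | succ N ih =>
    have hSX : Measurable[𝓕 N] fun w => (∑ i ∈ Finset.range N, X i w * e i w) * X N w :=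
      (measurable_sum_mul_innovation hX he N).mul (hX N)
    have c1 : ∫ w, ((∑ i ∈ Finset.range N, X i w * e i w) * X N w) * e N w ∂P = 0 := by
      have := (hindf N _ hSX).integral_fun_mul_eq_mul_integral
        ((hSX.mono (𝓕.le N) le_rfl).aestronglyMeasurable) (he' N).aestronglyMeasurable
      rw [this, hmean, mul_zero]
    have c2 : ∫ w, (X N w) ^ 2 * (e N w) ^ 2 ∂P
        = (∫ w, X N w ^ 2 ∂P) * ∫ w, e N w ^ 2 ∂P :=
      ((hindf N _ (hX N)).comp (φ := fun x => x ^ 2) (ψ := fun x => x ^ 2) (by fun_prop)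
        (by fun_prop)).integral_fun_mul_eq_mul_integral (by fun_prop) (by fun_prop)
    have i1 := (hS N).integrable_sq
    have i2 : Integrable (fun w => ((∑ i ∈ Finset.range N, X i w * e i w) * X N w) * e N w) P := by
      have := (hS N).integrable_mul (hXe N)
      refine this.congr (ae_of_all _ fun w => ?_)
      simp only [Pi.mul_apply]
      ring
    have i3 : Integrable (fun w => (X N w) ^ 2 * (e N w) ^ 2) P := by
      have := (hXe N).integrable_sq
      simpa only [mul_pow] using this
    calc ∫ w, (∑ i ∈ Finset.range (N + 1), X i w * e i w) ^ 2 ∂P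
        = ∫ w, ((∑ i ∈ Finset.range N, X i w * e i w) ^ 2 +
            2 * (((∑ i ∈ Finset.range N, X i w * e i w) * X N w) * e N w) +
            (X N w) ^ 2 * (e N w) ^ 2) ∂P := by
          congr 1 with w
          rw [Finset.sum_range_succ]
          ring
      _ = _ := by
          rw [integral_add (f := fun w => (∑ i ∈ Finset.range N, X i w * e i w) ^ 2 +
            2 * (((∑ i ∈ Finset.range N, X i w * e i w) * X N w) * e N w))
            (i1.add (i2.const_mul 2)) i3, integral_add i1 (i2.const_mul 2),
            integral_const_mul, c1, c2, ih, Finset.sum_range_succ]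
          ring

variable [IsProbabilityMeasure P]

/-- The compensating exponential cancels the Gaussian factor produced by each step, so the
compensated product is almost a martingale started at 1, and each of the k steps adds one error
term. The exponential prefactor is taken at N so that it is the same for all steps. -/
theorem norm_integral_exp_compensated_sub_one_le (hX : ∀ i, Measurable[𝓕 i] (X i))
    (he : ∀ i, Measurable[𝓕 (i + 1)] (e i))
    (hind : ∀ i, Indep (𝓕 i) (MeasurableSpace.comap (e i) inferInstance) P)
    {q M K v₀ : ℝ} (hq2 : 2 ≤ q) (hq3 : q ≤ 3) (h2 : ∀ i, MemLp (e i) 2 P)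
    (hmean : ∀ i, ∫ w, e i w ∂P = 0)
    (hint : ∀ i, Integrable (fun w => |e i w| ^ q) P) (hM : ∀ i, ∫ w, |e i w| ^ q ∂P ≤ M)
    (hv : ∀ i, ∫ w, e i w ^ 2 ∂P ≤ v₀) (hK : ∀ i w, |X i w| ≤ K) (s : ℝ) (N k : ℕ)
    (hk : k ≤ N) :
    ‖∫ w, Complex.exp ((s * ∑ i ∈ Finset.range k, X i w * e i w : ℝ) * Complex.I) *
        (Real.exp (s ^ 2 * (∑ i ∈ Finset.range k, X i w ^ 2 * ∫ w', e i w' ^ 2 ∂P) / 2) : ℝ) ∂P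
        - 1‖
      ≤ k * (Real.exp (s ^ 2 * (N * (K ^ 2 * v₀)) / 2) *
          (4 * (|s| * K) ^ q * M + ((|s| * K) ^ 2 * v₀ / 2) ^ 2)) := by
  set v : ℕ → ℝ := fun i => ∫ w, e i w ^ 2 ∂P with hvdef
  have hv0 : ∀ i, 0 ≤ v i := fun i => integral_nonneg fun w => sq_nonneg _
  have hv00 : 0 ≤ v₀ := (hv0 0).trans (hv 0)
  let S : ℕ → Ω → ℝ := fun k w => ∑ i ∈ Finset.range k, X i w * e i w
  let T : ℕ → Ω → ℝ := fun k w => ∑ i ∈ Finset.range k, X i w ^ 2 * v i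
  have hX' : ∀ i, Measurable (X i) := fun i => (hX i).mono (𝓕.le i) le_rfl
  have he' : ∀ i, Measurable (e i) := fun i => (he i).mono (𝓕.le _) le_rfl
  have hSk : ∀ k, Measurable[𝓕 k] (S k) := measurable_sum_mul_innovation hX he
  -- Predictability: the compensator including the next step is already known at time k.
  have hTk : ∀ k, Measurable[𝓕 k] (T (k + 1)) := fun k => by
    refine Finset.measurable_fun_sum _ fun i hi => ?_
    have hik : i ≤ k := Nat.lt_succ_iff.1 (Finset.mem_range.1 hi)
    exact (((hX i).mono (𝓕.mono hik) le_rfl).pow_const 2).mul_const _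
  have hSm : ∀ k, Measurable (S k) := fun k => (hSk k).mono (𝓕.le k) le_rfl
  have hTm : ∀ k, Measurable (T k) := fun k =>
    Finset.measurable_fun_sum _ fun i hi => ((hX' i).pow_const 2).mul_const _
  have hX2 : ∀ i w, X i w ^ 2 ≤ K ^ 2 := fun i w => by
    rw [← sq_abs]
    exact pow_le_pow_left₀ (abs_nonneg _) (hK i w) 2
  have hTb : ∀ k ≤ N, ∀ w, T k w ≤ N * (K ^ 2 * v₀) := fun k hk w => by
    calc T k w ≤ ∑ i ∈ Finset.range k, K ^ 2 * v₀ := Finset.sum_le_sum fun i _ =>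
          mul_le_mul (hX2 i w) (hv i) (hv0 i) (sq_nonneg _)
      _ = k * (K ^ 2 * v₀) := by simp
      _ ≤ _ := by gcongr
  let E : ℕ → Ω → ℝ := fun k w => Real.exp (s ^ 2 * T k w / 2)
  have hEb : ∀ k ≤ N, ∀ w, E k w ≤ Real.exp (s ^ 2 * (N * (K ^ 2 * v₀)) / 2) := fun k hk w => by
    refine Real.exp_le_exp.2 ?_
    have := hTb k hk w
    gcongr
  let G : ℕ → Ω → ℂ := fun k w => Complex.exp ((s * S k w : ℝ) * Complex.I) * (E k w : ℝ)
  have hnorm : ∀ j k, k ≤ N → ∀ w, ‖Complex.exp ((s * S j w : ℝ) * Complex.I) * (E k w : ℝ)‖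
      ≤ Real.exp (s ^ 2 * (N * (K ^ 2 * v₀)) / 2) := fun j k hk w => by
    rw [norm_mul, Complex.norm_exp_ofReal_mul_I, one_mul, Complex.norm_real, Real.norm_eq_abs,
      abs_of_pos (Real.exp_pos _)]
    exact hEb k hk w
  have hGi : ∀ k ≤ N, Integrable (G k) P := fun k hk =>
    Integrable.of_bound (by fun_prop) _ (ae_of_all _ (hnorm k k hk))
  change ‖∫ w, G k w ∂P - 1‖ ≤ _
  induction k with
  | zero => simp [G, S, E, T]
  | succ k ih =>
    have ih := ih (by omega)
    have hZ : Measurable[𝓕 k] fun w =>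
        Complex.exp ((s * S k w : ℝ) * Complex.I) * (E (k + 1) w : ℝ) := by
      refine Measurable.mul ?_ ?_
      · exact (Complex.measurable_exp.comp
          ((Complex.measurable_ofReal.comp ((hSk k).const_mul s)).mul_const _))
      · exact Complex.measurable_ofReal.comp
          (Real.measurable_exp.comp (((hTk k).const_mul _).div_const _))
    have hind' : IndepFun (fun w => (Complex.exp ((s * S k w : ℝ) * Complex.I) *
        (E (k + 1) w : ℝ), X k w)) (e k) P := by
      rw [IndepFun_iff_Indep]
      exact indep_of_indep_of_le_left (hind k) (hZ.prodMk (hX k)).comap_le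
    have step := norm_integral_mul_exp_sub_gaussian_le (hZ.mono (𝓕.le k) le_rfl) (hX' k) (he' k)
      hind' hq2 hq3 (h2 k) (hmean k) (hint k) (hM k) (hv k) (hnorm k (k + 1) hk) (hK k) s
    -- Factoring out E (k + 1) rather than E k leaves a prefactor measurable at time k, times the
    -- one-step difference between exponential and Gaussian.
    have heq : ∀ w, G (k + 1) w - G k w =
        Complex.exp ((s * S k w : ℝ) * Complex.I) * (E (k + 1) w : ℝ) *
        (Complex.exp ((s * X k w * e k w : ℝ) * Complex.I)
        - (Real.exp (-((s * X k w) ^ 2 * v k / 2)) : ℝ)) := fun w => by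
      have h1 : S (k + 1) w = S k w + X k w * e k w := Finset.sum_range_succ _ _
      have h2 : T (k + 1) w = T k w + X k w ^ 2 * v k := Finset.sum_range_succ _ _
      have h3 : Complex.exp ((s * S (k + 1) w : ℝ) * Complex.I)
          = Complex.exp ((s * S k w : ℝ) * Complex.I) *
            Complex.exp ((s * X k w * e k w : ℝ) * Complex.I) := by
        rw [← Complex.exp_add, h1]
        congr 1
        push_cast
        ring
      have h4 : E k w = E (k + 1) w * Real.exp (-((s * X k w) ^ 2 * v k / 2)) := by
        simp only [E]
        rw [← Real.exp_add, h2]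
        congr 1
        ring
      simp only [G]
      rw [h3, h4]
      push_cast
      ring
    have e2 : ∫ w, G (k + 1) w ∂P - 1 =
        (∫ w, G k w ∂P - 1) + ∫ w, (G (k + 1) w - G k w) ∂P := by
      rw [integral_sub (hGi _ hk) (hGi k (by omega))]
      ring
    rw [e2]
    refine (norm_add_le _ _).trans ?_
    simp_rw [heq]
    push_cast
    rw [add_mul, one_mul]
    refine add_le_add ih ?_
    push_cast at step
    exact step

/-- A central limit theorem for sums `∑ X_i e_i` with bounded predictable weights `X_i` and
innovations `e_i` independent of the past, in terms of characteristic functions. -/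
theorem tendsto_integral_exp_sum_mul_innovation (hX : ∀ i, Measurable[𝓕 i] (X i))
    (he : ∀ i, Measurable[𝓕 (i + 1)] (e i))
    (hind : ∀ i, Indep (𝓕 i) (MeasurableSpace.comap (e i) inferInstance) P)
    {q M K v₀ : ℝ} (hq2 : 2 < q) (hq3 : q ≤ 3) (h2 : ∀ i, MemLp (e i) 2 P)
    (hmean : ∀ i, ∫ w, e i w ∂P = 0)
    (hint : ∀ i, Integrable (fun w => |e i w| ^ q) P) (hM : ∀ i, ∫ w, |e i w| ^ q ∂P ≤ M)
    (hv : ∀ i, ∫ w, e i w ^ 2 ∂P ≤ v₀) (hK : ∀ i w, |X i w| ≤ K) {σ2 : ℝ}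
    (hlim : Tendsto (fun N : ℕ => ∫ w, |(N : ℝ)⁻¹ *
      (∑ i ∈ Finset.range N, X i w ^ 2 * ∫ w', e i w' ^ 2 ∂P) - σ2| ∂P) atTop (𝓝 0)) (u : ℝ) :
    Tendsto (fun N : ℕ => ∫ w, Complex.exp ((u * ((√(N : ℝ))⁻¹ *
      ∑ i ∈ Finset.range N, X i w * e i w) : ℝ) * Complex.I) ∂P) atTop
      (𝓝 ((Real.exp (-(u ^ 2 * σ2 / 2)) : ℝ) : ℂ)) := by
  set v : ℕ → ℝ := fun i => ∫ w, e i w ^ 2 ∂P with hvdef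
  have hv0 : ∀ i, 0 ≤ v i := fun i => integral_nonneg fun w => sq_nonneg _
  have hv00 : 0 ≤ v₀ := (hv0 0).trans (hv 0)
  have hX' : ∀ i, Measurable (X i) := fun i => (hX i).mono (𝓕.le i) le_rfl
  have he' : ∀ i, Measurable (e i) := fun i => (he i).mono (𝓕.le _) le_rfl
  have hK0 : 0 ≤ K := by
    obtain ⟨w⟩ := P.nonempty_of_neZero
    exact (abs_nonneg _).trans (hK 0 w)
  let S : ℕ → Ω → ℝ := fun k w => ∑ i ∈ Finset.range k, X i w * e i w
  let T : ℕ → Ω → ℝ := fun k w => ∑ i ∈ Finset.range k, X i w ^ 2 * v i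
  have hSm : ∀ k, Measurable (S k) := fun k =>
    Finset.measurable_fun_sum _ fun i hi => (hX' i).mul (he' i)
  have hTm : ∀ k, Measurable (T k) := fun k =>
    Finset.measurable_fun_sum _ fun i hi => ((hX' i).pow_const 2).mul_const _
  have hX2 : ∀ i w, X i w ^ 2 ≤ K ^ 2 := fun i w => by
    rw [← sq_abs]
    exact pow_le_pow_left₀ (abs_nonneg _) (hK i w) 2
  have hT0 : ∀ k w, 0 ≤ T k w := fun k w =>
    Finset.sum_nonneg fun i _ => mul_nonneg (sq_nonneg _) (hv0 i)
  have hTb : ∀ N : ℕ, ∀ w, (N : ℝ)⁻¹ * T N w ≤ K ^ 2 * v₀ := fun k w => by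
    have : T k w ≤ k * (K ^ 2 * v₀) := by
      calc T k w ≤ ∑ i ∈ Finset.range k, K ^ 2 * v₀ := Finset.sum_le_sum fun i _ =>
            mul_le_mul (hX2 i w) (hv i) (hv0 i) (sq_nonneg _)
        _ = k * (K ^ 2 * v₀) := by simp
    rcases k.eq_zero_or_pos with rfl | hk
    · simp
      positivity
    · rw [inv_mul_le_iff₀ (by exact_mod_cast hk)]
      exact this
  set R : ℝ := max (u ^ 2 * (K ^ 2 * v₀) / 2) (u ^ 2 * σ2 / 2) with hR
  -- At s = u/√N, the N one-step errors of orders N^{-q/2} and N^{-2} add up to the first bracket.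
  -- The last term is the cost of replacing T N / N by σ2 in the exponent, with R bounding both
  -- exponents.
  let bound : ℕ → ℝ := fun N => Real.exp (u ^ 2 * (K ^ 2 * v₀) / 2) *
      (4 * (|u| * K) ^ q * M * (N : ℝ) ^ (-(q / 2 - 1)) +
        ((|u| * K) ^ 2 * v₀ / 2) ^ 2 * (N : ℝ)⁻¹) +
      Real.exp R * (u ^ 2 / 2) * ∫ w, |(N : ℝ)⁻¹ * T N w - σ2| ∂P
  have hbound : Tendsto bound atTop (𝓝 0) := by
    have t1 : Tendsto (fun N : ℕ => (N : ℝ) ^ (-(q / 2 - 1))) atTop (𝓝 0) :=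
      (tendsto_rpow_neg_atTop (by linarith)).comp tendsto_natCast_atTop_atTop
    have t2 : Tendsto (fun N : ℕ => (N : ℝ)⁻¹) atTop (𝓝 0) := tendsto_inv_atTop_nhds_zero_nat
    have := ((((t1.const_mul (4 * (|u| * K) ^ q * M)).add
      (t2.const_mul (((|u| * K) ^ 2 * v₀ / 2) ^ 2))).const_mul
      (Real.exp (u ^ 2 * (K ^ 2 * v₀) / 2))).add (hlim.const_mul (Real.exp R * (u ^ 2 / 2))))
    simp only [mul_zero, add_zero] at this
    exact this
  have key : ∀ N : ℕ, 1 ≤ N → ‖(∫ w, Complex.exp ((u * ((√(N : ℝ))⁻¹ * S N w) : ℝ) * Complex.I) ∂P)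
      * (Real.exp (u ^ 2 * σ2 / 2) : ℝ) - 1‖ ≤ bound N := by
    intro N hN
    have hNpos : (0 : ℝ) < N := by exact_mod_cast hN
    have hsq : √(N : ℝ) ^ 2 = N := Real.sq_sqrt hNpos.le
    have hsqp : 0 < √(N : ℝ) := Real.sqrt_pos.2 hNpos
    set s : ℝ := u * (√(N : ℝ))⁻¹ with hs
    have hs2 : s ^ 2 = u ^ 2 * (N : ℝ)⁻¹ := by rw [hs, mul_pow, inv_pow, hsq]
    have b1 := norm_integral_exp_compensated_sub_one_le hX he hind hq2.le hq3 h2 hmean hint hM hv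
      hK s N N le_rfl
    have habs : |s| * K = (|u| * K) * (√(N : ℝ))⁻¹ := by
      rw [hs, abs_mul, abs_of_pos (inv_pos.2 hsqp)]
      ring
    have hrp : (|s| * K) ^ q = (|u| * K) ^ q * (N : ℝ) ^ (-(q / 2)) := by
      rw [habs, Real.mul_rpow (by positivity) (by positivity), Real.sqrt_eq_rpow,
        ← Real.rpow_neg hNpos.le, ← Real.rpow_mul hNpos.le]
      congr 2
      ring
    have hrp2 : (N : ℝ) * (N : ℝ) ^ (-(q / 2)) = (N : ℝ) ^ (-(q / 2 - 1)) := by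
      rw [← Real.rpow_one_add' hNpos.le (by linarith)]
      congr 1
      ring
    have hsqr : (|s| * K) ^ 2 = (|u| * K) ^ 2 * (N : ℝ)⁻¹ := by
      rw [habs, mul_pow, inv_pow, hsq]
    have e1 : (N : ℝ) * (Real.exp (s ^ 2 * (N * (K ^ 2 * v₀)) / 2) *
          (4 * (|s| * K) ^ q * M + ((|s| * K) ^ 2 * v₀ / 2) ^ 2))
        = Real.exp (u ^ 2 * (K ^ 2 * v₀) / 2) *
      (4 * (|u| * K) ^ q * M * (N : ℝ) ^ (-(q / 2 - 1)) +
        ((|u| * K) ^ 2 * v₀ / 2) ^ 2 * (N : ℝ)⁻¹) := by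
      rw [← hrp2, hrp, hsqr, hs2]
      have : u ^ 2 * (N : ℝ)⁻¹ * (N * (K ^ 2 * v₀)) / 2 = u ^ 2 * (K ^ 2 * v₀) / 2 := by
        field_simp
      rw [this]
      field_simp
    rw [e1] at b1
    have i1 : Integrable (fun w => Complex.exp ((u * ((√(N : ℝ))⁻¹ * S N w) : ℝ) * Complex.I)) P := by
      refine Integrable.of_bound (by fun_prop) 1 (ae_of_all _ fun w => ?_)
      rw [Complex.norm_exp_ofReal_mul_I]
    have i2 : Integrable (fun w => Complex.exp ((s * S N w : ℝ) * Complex.I) *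
        (Real.exp (s ^ 2 * T N w / 2) : ℝ)) P := by
      refine Integrable.of_bound (by fun_prop) (Real.exp (u ^ 2 * (K ^ 2 * v₀) / 2))
        (ae_of_all _ fun w => ?_)
      rw [norm_mul, Complex.norm_exp_ofReal_mul_I, one_mul, Complex.norm_real, Real.norm_eq_abs,
        abs_of_pos (Real.exp_pos _), hs2, mul_assoc]
      have := hTb N w
      gcongr
    have i3 : Integrable (fun w => |(N : ℝ)⁻¹ * T N w - σ2|) P := by
      refine Integrable.of_bound (by fun_prop) (K ^ 2 * v₀ + |σ2|) (ae_of_all _ fun w => ?_)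
      rw [Real.norm_eq_abs, abs_abs]
      refine (abs_sub _ _).trans ?_
      rw [abs_of_nonneg (mul_nonneg (by positivity) (hT0 N w))]
      linarith [hTb N w]
    have b2 : ‖(∫ w, Complex.exp ((u * ((√(N : ℝ))⁻¹ * S N w) : ℝ) * Complex.I) ∂P)
        * (Real.exp (u ^ 2 * σ2 / 2) : ℝ) - ∫ w, Complex.exp ((s * S N w : ℝ) * Complex.I) *
        (Real.exp (s ^ 2 * T N w / 2) : ℝ) ∂P‖
        ≤ Real.exp R * (u ^ 2 / 2) * ∫ w, |(N : ℝ)⁻¹ * T N w - σ2| ∂P := by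
      rw [← integral_mul_const, ← integral_sub (i1.mul_const _) i2, ← integral_const_mul]
      refine norm_integral_le_of_norm_le (i3.const_mul _) (ae_of_all _ fun w => ?_)
      have : u * ((√(N : ℝ))⁻¹ * S N w) = s * S N w := by rw [hs]; ring
      rw [this, ← mul_sub, norm_mul, Complex.norm_exp_ofReal_mul_I, one_mul,
        ← Complex.ofReal_sub, Complex.norm_real, Real.norm_eq_abs]
      refine (Real.abs_exp_sub_exp_le (R := R) (le_max_right _ _)
        (le_trans ?_ (le_max_left _ _))).trans (le_of_eq ?_)
      · rw [hs2, mul_assoc]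
        have := hTb N w
        gcongr
      · have e3 : u ^ 2 * σ2 / 2 - s ^ 2 * T N w / 2
            = -(u ^ 2 / 2 * ((N : ℝ)⁻¹ * T N w - σ2)) := by
          rw [hs2]
          ring
        rw [e3, abs_neg, abs_mul, abs_of_nonneg (show 0 ≤ u ^ 2 / 2 by positivity), mul_assoc]
    exact (norm_sub_le_norm_sub_add_norm_sub _ _ _).trans
      ((add_le_add b2 b1).trans (le_of_eq (add_comm _ _)))
  have t1 : Tendsto (fun N : ℕ => (∫ w, Complex.exp ((u * ((√(N : ℝ))⁻¹ * S N w) : ℝ) * Complex.I) ∂P)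
      * (Real.exp (u ^ 2 * σ2 / 2) : ℝ)) atTop (𝓝 1) := by
    rw [tendsto_iff_norm_sub_tendsto_zero]
    refine squeeze_zero' (Eventually.of_forall fun _ => norm_nonneg _) ?_ hbound
    filter_upwards [eventually_ge_atTop 1] with N hN using key N hN
  have t2 := t1.mul_const ((Real.exp (-(u ^ 2 * σ2 / 2)) : ℝ) : ℂ)
  rw [one_mul] at t2
  refine t2.congr fun N => ?_
  rw [mul_assoc, ← Complex.ofReal_mul, ← Real.exp_add, add_neg_cancel, Real.exp_zero,
    Complex.ofReal_one, mul_one]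

end martingale

/-! ### Weak law of large numbers for weakly correlated variables. -/

section weakLaw

variable {Ω : Type*} [mΩ : MeasurableSpace Ω] {P : Measure Ω} [IsProbabilityMeasure P]

/-- This is nonnegativity of the variance of |g|. -/
theorem integral_abs_le_sqrt_integral_sq {g : Ω → ℝ} (hg : MemLp g 2 P) :
    ∫ w, |g w| ∂P ≤ √(∫ w, g w ^ 2 ∂P) := by
  refine Real.le_sqrt_of_sq_le ?_
  have h := variance_nonneg |g| P
  rw [variance_eq_sub hg.abs] at h
  simp only [Pi.pow_apply, Pi.abs_apply, sq_abs] at h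
  linarith

/-- Adding the N-th variable costs its variance and twice its covariances at lags 1 to N, hence at
most twice the partial sum of ρ. A bound depending only on the lag replaces stationarity. -/
theorem variance_sum_range_le {Y : ℕ → Ω → ℝ} (hY : ∀ i, MemLp (Y i) 2 P) {ρ : ℕ → ℝ}
    (hρ : ∀ i m, |cov[Y i, Y (i + m); P]| ≤ ρ m) (N : ℕ) :
    Var[fun w => ∑ i ∈ Finset.range N, Y i w; P] ≤ 2 * N * ∑ m ∈ Finset.range N, ρ m := by
  have hρ0 : ∀ m, 0 ≤ ρ m := fun m => (abs_nonneg _).trans (hρ 0 m)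
  induction N with
  | zero => simp [variance_eq_integral measurable_const.aemeasurable]
  | succ N ih =>
    have hS : MemLp (fun w => ∑ i ∈ Finset.range N, Y i w) 2 P := memLp_finsetSum _ fun i _ => hY i
    have h1 : Var[fun w => ∑ i ∈ Finset.range (N + 1), Y i w; P]
        = Var[fun w => ∑ i ∈ Finset.range N, Y i w; P]
          + 2 * cov[fun w => ∑ i ∈ Finset.range N, Y i w, Y N; P] + Var[Y N; P] := by
      rw [← variance_add hS (hY N)]
      congr 1
      ext w
      simp [Finset.sum_range_succ]
    have h2 : cov[fun w => ∑ i ∈ Finset.range N, Y i w, Y N; P]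
        ≤ ∑ i ∈ Finset.range N, ρ (N - i) := by
      rw [covariance_fun_sum_left' (fun i _ => hY i) (hY N)]
      refine Finset.sum_le_sum fun i hi => ?_
      have := hρ i (N - i)
      rw [Nat.add_sub_cancel' (Finset.mem_range.1 hi).le] at this
      exact (le_abs_self _).trans this
    have h3 : Var[Y N; P] ≤ ρ 0 := by
      rw [← covariance_self (hY N).aemeasurable]
      exact (le_abs_self _).trans (hρ N 0)
    have h4 : ∑ i ∈ Finset.range N, ρ (N - i) + ρ 0 = ∑ m ∈ Finset.range (N + 1), ρ m := by
      rw [← Finset.sum_range_reflect ρ (N + 1), Finset.sum_range_succ]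
      simp
    have h5 : ∑ m ∈ Finset.range N, ρ m ≤ ∑ m ∈ Finset.range (N + 1), ρ m := by
      rw [Finset.sum_range_succ]
      linarith [hρ0 N]
    have h6 : 2 * (N : ℝ) * ∑ m ∈ Finset.range N, ρ m
        ≤ 2 * N * ∑ m ∈ Finset.range (N + 1), ρ m := by gcongr
    have h7 := hρ0 0
    rw [h1]
    push_cast
    linarith

/-- A weak law of large numbers under decay of correlations. -/
theorem tendsto_integral_abs_average_sub {Y : ℕ → Ω → ℝ} (hY : ∀ i, MemLp (Y i) 2 P) {ρ : ℕ → ℝ}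
    (hρ : ∀ i m, |cov[Y i, Y (i + m); P]| ≤ ρ m) (hρ0 : Tendsto ρ atTop (𝓝 0)) {μ : ℝ}
    (hμ : Tendsto (fun i => ∫ w, Y i w ∂P) atTop (𝓝 μ)) :
    Tendsto (fun N : ℕ => ∫ w, |(N : ℝ)⁻¹ * (∑ i ∈ Finset.range N, Y i w) - μ| ∂P)
      atTop (𝓝 0) := by
  have hS : ∀ N, MemLp (fun w => ∑ i ∈ Finset.range N, Y i w) 2 P := fun N =>
    memLp_finsetSum _ fun i _ => hY i
  let W : ℕ → Ω → ℝ := fun N w => (N : ℝ)⁻¹ * ∑ i ∈ Finset.range N, Y i w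
  have hW : ∀ N, MemLp (W N) 2 P := fun N => (hS N).const_mul _
  have hEW : ∀ N, ∫ w, W N w ∂P = (N : ℝ)⁻¹ * ∑ i ∈ Finset.range N, ∫ w, Y i w ∂P := fun N => by
    simp only [W]
    rw [integral_const_mul, integral_finsetSum _ fun i _ => (hY i).integrable (by norm_num)]
  have t1 : Tendsto (fun N => |∫ w, W N w ∂P - μ|) atTop (𝓝 0) := by
    have := (hμ.cesaro.sub_const μ).abs
    simp only [sub_self, abs_zero] at this
    refine this.congr fun N => ?_
    rw [hEW]
  have hVar : ∀ N, Var[W N; P] ≤ 2 * ((N : ℝ)⁻¹ * ∑ m ∈ Finset.range N, ρ m) := fun N => by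
    have h := variance_sum_range_le hY hρ N
    have e : Var[W N; P] = (N : ℝ)⁻¹ ^ 2 * Var[fun w => ∑ i ∈ Finset.range N, Y i w; P] :=
      variance_const_mul _ _ _
    rw [e]
    refine (mul_le_mul_of_nonneg_left h (by positivity)).trans (le_of_eq ?_)
    rcases N.eq_zero_or_pos with rfl | hN
    · simp
    · have : (N : ℝ) ≠ 0 := by exact_mod_cast hN.ne'
      field_simp
  have t2 : Tendsto (fun N : ℕ => √(2 * ((N : ℝ)⁻¹ * ∑ m ∈ Finset.range N, ρ m))) atTop (𝓝 0) := by
    have := (hρ0.cesaro.const_mul 2).sqrt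
    simpa using this
  have t3 := t2.add t1
  rw [add_zero] at t3
  refine squeeze_zero (fun N => integral_nonneg fun w => abs_nonneg _) (fun N => ?_) t3
  -- The deviation from μ splits into the fluctuation about the mean, controlled by the variance,
  -- and the bias; both are governed by Cesàro means.
  have hc : MemLp (fun w => W N w - ∫ w', W N w' ∂P) 2 P := (hW N).sub (memLp_const _)
  have b1 : ∫ w, |W N w - ∫ w', W N w' ∂P| ∂P ≤ √(2 * ((N : ℝ)⁻¹ * ∑ m ∈ Finset.range N, ρ m)) := by
    refine (integral_abs_le_sqrt_integral_sq hc).trans (Real.sqrt_le_sqrt ?_)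
    rw [← variance_eq_integral (hW N).aemeasurable]
    exact hVar N
  have i1 : Integrable (fun w => |W N w - ∫ w', W N w' ∂P|) P :=
    (hc.integrable (by norm_num)).abs
  calc ∫ w, |W N w - μ| ∂P
      ≤ ∫ w, (|W N w - ∫ w', W N w' ∂P| + |∫ w', W N w' ∂P - μ|) ∂P := by
        refine integral_mono ?_ (i1.add (integrable_const _)) fun w => abs_sub_le _ _ _
        exact (((hW N).integrable (by norm_num)).sub (integrable_const _)).abs
    _ = ∫ w, |W N w - ∫ w', W N w' ∂P| ∂P + |∫ w', W N w' ∂P - μ| := by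
        rw [integral_add i1 (integrable_const _), integral_const, probReal_univ, one_smul]
    _ ≤ _ := by gcongr

/-- If `V` is well approximated by a function `V'` of a variable independent of `U`, then `U`
and `V` are almost uncorrelated. -/
theorem abs_covariance_le_of_indepFun {U V V' : Ω → ℝ} (hU : Measurable U) (hV : Measurable V)
    (hV' : Measurable V') {B : ℝ} (hUB : ∀ w, |U w| ≤ B) (hVB : ∀ w, |V w| ≤ B)
    (hVB' : ∀ w, |V' w| ≤ B) (hind : IndepFun U V' P) :
    |cov[U, V; P]| ≤ 2 * B * ∫ w, |V w - V' w| ∂P := by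
  have mU : MemLp U 2 P := MemLp.of_bound hU.aestronglyMeasurable B (ae_of_all _ hUB)
  have mV : MemLp V 2 P := MemLp.of_bound hV.aestronglyMeasurable B (ae_of_all _ hVB)
  have mV' : MemLp V' 2 P := MemLp.of_bound hV'.aestronglyMeasurable B (ae_of_all _ hVB')
  have mD : MemLp (V - V') 2 P := mV.sub mV'
  have hB : 0 ≤ B := by
    obtain ⟨w⟩ := P.nonempty_of_neZero
    exact (abs_nonneg _).trans (hUB w)
  have iD : Integrable (fun w => |V w - V' w|) P := (mD.integrable (by norm_num)).abs
  -- V' is uncorrelated with U, so only the small difference remains; the two terms of its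
  -- covariance give the factor 2.
  have h1 : cov[U, V; P] = cov[U, V - V'; P] := by
    rw [covariance_sub_right mU mV mV', hind.covariance_eq_zero mU mV', sub_zero]
  rw [h1, covariance_eq_sub mU mD]
  have b1 : |∫ w, (U * (V - V')) w ∂P| ≤ B * ∫ w, |V w - V' w| ∂P := by
    rw [← integral_const_mul, ← Real.norm_eq_abs]
    refine norm_integral_le_of_norm_le (iD.const_mul _) (ae_of_all _ fun w => ?_)
    simp only [Pi.mul_apply, Pi.sub_apply, norm_mul, Real.norm_eq_abs]
    exact mul_le_mul_of_nonneg_right (hUB w) (abs_nonneg _)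
  have b2 : |∫ w, U w ∂P| ≤ B := by
    rw [← Real.norm_eq_abs]
    refine (norm_integral_le_of_norm_le_const (ae_of_all _ hUB)).trans (le_of_eq ?_)
    rw [probReal_univ, mul_one]
  have b3 : |∫ w, (V - V') w ∂P| ≤ ∫ w, |V w - V' w| ∂P := abs_integral_le_integral_abs
  calc _ ≤ |∫ w, (U * (V - V')) w ∂P| + |(∫ w, U w ∂P) * ∫ w, (V - V') w ∂P| := abs_sub _ _
    _ ≤ B * ∫ w, |V w - V' w| ∂P + B * ∫ w, |V w - V' w| ∂P := by
        rw [abs_mul]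
        gcongr
    _ = _ := by ring

end weakLaw

/-! ### Laplace transforms of functions and self-convolution. -/

section laplace

variable {F f : ℝ → ℝ}

theorem selfConv_nonneg (hf : ∀ t : ℝ, 0 < t → 0 ≤ f t) {t : ℝ} (ht : 0 < t) :
    0 ≤ selfConv f t := by
  rw [selfConv, intervalIntegral.integral_of_le ht.le, integral_Ioc_eq_integral_Ioo]
  exact setIntegral_nonneg measurableSet_Ioo fun s hs =>
    mul_nonneg (hf s hs.1) (hf _ (sub_pos.2 hs.2))

/-- Exponential tilting commutes with convolution, so the convolution theory of integrable functions
applies to the tilted f even when f is not integrable. -/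
theorem exp_mul_selfConv (f : ℝ → ℝ) (x T : ℝ) :
    Real.exp (-x * T) * selfConv f T
      = ∫ s in (0 : ℝ)..T, (Real.exp (-x * s) * f s) * (Real.exp (-x * (T - s)) * f (T - s)) := by
  rw [selfConv, ← intervalIntegral.integral_const_mul]
  refine intervalIntegral.integral_congr fun s _ => ?_
  have : Real.exp (-x * T) = Real.exp (-x * s) * Real.exp (-x * (T - s)) := by
    rw [← Real.exp_add]
    ring_nf
  simp only [this]
  ring

theorem integrableOn_selfConv_integral {g : ℝ → ℝ} (hg : IntegrableOn g (Set.Ioi 0)) :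
    IntegrableOn (fun T => ∫ s in (0 : ℝ)..T, g s * g (T - s)) (Set.Ioi 0) := by
  have h := (integrable_posConvolution hg hg (ContinuousLinearMap.mul ℝ ℝ)).integrableOn
    (s := Set.Ioi 0)
  refine h.congr_fun (fun T hT => ?_) measurableSet_Ioi
  simp only [posConvolution, Set.indicator_of_mem hT, ContinuousLinearMap.mul_apply']

namespace IsPolyLaplace

variable (hF : IsPolyLaplace F f)
include hF

theorem integrableOn_exp_mul_selfConv {x : ℝ} (hx : 0 < x) :
    IntegrableOn (fun t => Real.exp (-x * t) * selfConv f t) (Set.Ioi 0) := by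
  simp_rw [exp_mul_selfConv]
  exact integrableOn_selfConv_integral (hF.integrable x hx)

/-- The square becomes linear in the kernel e^{-xt}; averaging over a random x then needs only its
Laplace transform. -/
theorem integral_exp_mul_selfConv {x : ℝ} (hx : 0 < x) :
    ∫ t in Set.Ioi 0, Real.exp (-x * t) * selfConv f t = laplaceTransform f x ^ 2 := by
  simp_rw [exp_mul_selfConv]
  have := integral_posConvolution (hF.integrable x hx) (hF.integrable x hx)
    (ContinuousLinearMap.mul ℝ ℝ)
  simp only [ContinuousLinearMap.mul_apply'] at this
  rw [this, laplaceTransform, sq]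

/-- Measurability of f is not a separate hypothesis; it is recovered by untilting the integrable
function at s = 1. -/
theorem aestronglyMeasurable_right : AEStronglyMeasurable f (volume.restrict (Set.Ioi 0)) := by
  have h : AEStronglyMeasurable (fun t => Real.exp t * (Real.exp (-1 * t) * f t))
      (volume.restrict (Set.Ioi 0)) :=
    (Real.continuous_exp.aestronglyMeasurable).mul (hF.integrable 1 one_pos).aestronglyMeasurable
  refine h.congr (ae_of_all _ fun t => ?_)
  simp only
  rw [← mul_assoc, ← Real.exp_add]
  simp

theorem aestronglyMeasurable_selfConv :
    AEStronglyMeasurable (selfConv f) (volume.restrict (Set.Ioi 0)) := by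
  have h : AEStronglyMeasurable (fun t => Real.exp t * (Real.exp (-1 * t) * selfConv f t))
      (volume.restrict (Set.Ioi 0)) :=
    (Real.continuous_exp.aestronglyMeasurable).mul
      (hF.integrableOn_exp_mul_selfConv one_pos).aestronglyMeasurable
  refine h.congr (ae_of_all _ fun t => ?_)
  simp only
  rw [← mul_assoc, ← Real.exp_add]
  simp

theorem measurable_laplaceTransform : Measurable (laplaceTransform f) := by
  obtain ⟨g, hg, hfg⟩ := hF.aestronglyMeasurable_right
  have h1 : laplaceTransform f = fun s => ∫ t in Set.Ioi (0 : ℝ), Real.exp (-s * t) * g t := by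
    ext s
    refine integral_congr_ae ?_
    filter_upwards [hfg] with t ht
    rw [ht]
  rw [h1]
  have hm : StronglyMeasurable (Function.uncurry fun s t : ℝ => Real.exp (-s * t) * g t) := by
    refine Measurable.stronglyMeasurable ?_
    have := hg.measurable
    fun_prop
  exact hm.integral_prod_right.measurable

theorem laplaceTransform_nonneg {x : ℝ} : 0 ≤ laplaceTransform f x :=
  setIntegral_nonneg measurableSet_Ioi fun t ht =>
    mul_nonneg (Real.exp_pos _).le (hF.nonneg_right t ht)

theorem laplaceTransform_anti {x y : ℝ} (hx : 0 < x) (hxy : x ≤ y) :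
    laplaceTransform f y ≤ laplaceTransform f x := by
  refine setIntegral_mono_on (hF.integrable y (hx.trans_le hxy)) (hF.integrable x hx)
    measurableSet_Ioi fun t ht => ?_
  have ht' : 0 < t := ht
  refine mul_le_mul_of_nonneg_right (Real.exp_le_exp.2 ?_) (hF.nonneg_right t ht)
  nlinarith

/-- A Laplace transform shifted away from the origin is Lipschitz, also for the distance
`1 - exp (-|x - y|)`. -/
theorem exists_laplaceTransform_sub_le {ε : ℝ} (hε : 0 < ε) :
    ∃ C, 0 ≤ C ∧ ∀ x r : ℝ, 0 ≤ x → 0 ≤ r →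
      laplaceTransform f (x + ε) - laplaceTransform f (x + r + ε) ≤ C * (1 - Real.exp (-r)) := by
  have hε2 : 0 < ε / 2 := by positivity
  -- Half of the exponential decay absorbs the factor 1 + t; the other half keeps f integrable.
  have key : ∀ t : ℝ, 0 < t → Real.exp (-ε * t) * (1 + t)
      ≤ (1 + 2 / ε) * Real.exp (-(ε / 2) * t) := fun t ht => by
    have h1 : Real.exp (-ε * t) = Real.exp (-(ε / 2) * t) * Real.exp (-(ε / 2 * t)) := by
      rw [← Real.exp_add]
      ring_nf
    have h2 : ε / 2 * t + 1 ≤ Real.exp (ε / 2 * t) := Real.add_one_le_exp _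
    have h3 : Real.exp (-(ε / 2 * t)) * (1 + t) ≤ 1 + 2 / ε := by
      rw [Real.exp_neg, inv_mul_le_iff₀ (Real.exp_pos _)]
      have h4 : 1 ≤ Real.exp (ε / 2 * t) := by nlinarith
      have h5 : t = 2 / ε * (ε / 2 * t) := by field_simp
      have h6 : t ≤ 2 / ε * Real.exp (ε / 2 * t) := by
        nth_rewrite 1 [h5]
        gcongr
        linarith
      linarith
    rw [h1]
    calc _ = Real.exp (-(ε / 2) * t) * (Real.exp (-(ε / 2 * t)) * (1 + t)) := by ring
      _ ≤ Real.exp (-(ε / 2) * t) * (1 + 2 / ε) := by gcongr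
      _ = _ := by ring
  refine ⟨(1 + 2 / ε) * laplaceTransform f (ε / 2),
    mul_nonneg (by positivity) hF.laplaceTransform_nonneg, fun x r hx hr => ?_⟩
  have i1 := hF.integrable (x + ε) (by positivity)
  have i2 := hF.integrable (x + r + ε) (by positivity)
  have i3 := hF.integrable (ε / 2) hε2
  set q := Real.exp (-r) with hq
  have hq1 : q ≤ 1 := Real.exp_le_one_iff.2 (by linarith)
  rw [laplaceTransform, laplaceTransform, laplaceTransform, ← integral_sub i1 i2,
    mul_right_comm, ← integral_const_mul]
  refine setIntegral_mono_on (i1.sub i2) (i3.const_mul _) measurableSet_Ioi fun t ht => ?_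
  have ht' : 0 < t := ht
  -- With q = e^{-r}, monotonicity in the exponent gives 1 - q^t ≤ 1 - q for t ≤ 1, and Bernoulli
  -- gives 1 - q^t ≤ t (1 - q) for t ≥ 1.
  have hb : 1 - Real.exp (-r * t) ≤ (1 + t) * (1 - q) := by
    have e : Real.exp (-r * t) = q ^ t := by rw [hq, ← Real.exp_mul]
    rw [e]
    rcases le_total t 1 with h | h
    · have : q ≤ q ^ t := by
        have := Real.rpow_le_rpow_of_exponent_ge (Real.exp_pos (-r)) hq1 h
        rwa [Real.rpow_one] at this
      nlinarith
    · have := one_add_mul_self_le_rpow_one_add (s := q - 1)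
        (by linarith [Real.exp_pos (-r)]) h
      rw [add_sub_cancel] at this
      nlinarith
  have hsplit : Real.exp (-(x + r + ε) * t) = Real.exp (-(x + ε) * t) * Real.exp (-r * t) := by
    rw [← Real.exp_add]
    ring_nf
  have hmono : Real.exp (-(x + ε) * t) ≤ Real.exp (-ε * t) := Real.exp_le_exp.2 (by nlinarith)
  have h0 : 0 ≤ 1 - Real.exp (-r * t) := sub_nonneg.2 (Real.exp_le_one_iff.2 (by nlinarith))
  have hft := hF.nonneg_right t ht
  calc Real.exp (-(x + ε) * t) * f t - Real.exp (-(x + r + ε) * t) * f t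
      = Real.exp (-(x + ε) * t) * (1 - Real.exp (-r * t)) * f t := by rw [hsplit]; ring
    _ ≤ Real.exp (-ε * t) * ((1 + t) * (1 - q)) * f t := by gcongr
    _ = (Real.exp (-ε * t) * (1 + t)) * (1 - q) * f t := by ring
    _ ≤ ((1 + 2 / ε) * Real.exp (-(ε / 2) * t)) * (1 - q) * f t := by
        have := key t ht'
        have : 0 ≤ 1 - q := by linarith
        gcongr
    _ = _ := by ring

/-- On (0, 1] compare with the tilted function at s = 1; beyond 1, a weight of exponent m + 2 leaves
t^{-2} after the growth of order m. -/
theorem exists_integrableOn_rpow_mul :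
    ∃ M : ℝ, 0 ≤ M ∧ IntegrableOn (fun t => (1 + t) ^ (-M) * f t) (Set.Ioi 0) := by
  obtain ⟨c, hc, m, hm, hgrow⟩ := hF.growth
  refine ⟨m + 2, by linarith, ?_⟩
  have hmeas : AEStronglyMeasurable (fun t => (1 + t) ^ (-(m + 2)) * f t)
      (volume.restrict (Set.Ioi 0)) := by
    refine AEStronglyMeasurable.mul ?_ hF.aestronglyMeasurable_right
    exact (by fun_prop : Measurable fun t : ℝ => (1 + t) ^ (-(m + 2))).aestronglyMeasurable
  have hsplit : Set.Ioi (0 : ℝ) = Set.Ioc 0 1 ∪ Set.Ioi 1 := by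
    rw [Set.Ioc_union_Ioi_eq_Ioi zero_le_one]
  rw [hsplit]
  refine IntegrableOn.union ?_ ?_
  · have h1 : IntegrableOn (fun t => Real.exp 1 * (Real.exp (-1 * t) * f t)) (Set.Ioc 0 1) :=
      ((hF.integrable 1 one_pos).mono_set Set.Ioc_subset_Ioi_self).const_mul _
    refine Integrable.mono' h1 (hmeas.mono_measure
      (Measure.restrict_mono Set.Ioc_subset_Ioi_self le_rfl)) ?_
    refine (ae_restrict_iff' measurableSet_Ioc).2 (ae_of_all _ fun t ht => ?_)
    have hft := hF.nonneg_right t ht.1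
    have h2 : (1 + t) ^ (-(m + 2)) ≤ 1 :=
      Real.rpow_le_one_of_one_le_of_nonpos (by linarith [ht.1]) (by linarith)
    have h3 : 0 ≤ (1 + t) ^ (-(m + 2)) := Real.rpow_nonneg (by linarith [ht.1]) _
    rw [norm_mul, Real.norm_eq_abs, Real.norm_eq_abs, abs_of_nonneg h3, abs_of_nonneg hft,
      ← mul_assoc, ← Real.exp_add]
    refine mul_le_mul_of_nonneg_right (h2.trans (Real.one_le_exp ?_)) hft
    linarith [ht.2]
  · have h1 : IntegrableOn (fun t : ℝ => c * t ^ (-2 : ℝ)) (Set.Ioi 1) :=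
      (integrableOn_Ioi_rpow_of_lt (by norm_num) one_pos).const_mul _
    refine Integrable.mono' h1 (hmeas.mono_measure
      (Measure.restrict_mono (Set.Ioi_subset_Ioi zero_le_one) le_rfl)) ?_
    refine (ae_restrict_iff' measurableSet_Ioi).2 (ae_of_all _ fun t ht => ?_)
    have ht1 : 1 < t := ht
    have hft := hF.nonneg_right t (by linarith)
    have hpos : 0 < 1 + t := by linarith
    have h3 : 0 ≤ (1 + t) ^ (-(m + 2)) := Real.rpow_nonneg hpos.le _
    rw [norm_mul, Real.norm_eq_abs, Real.norm_eq_abs, abs_of_nonneg h3, abs_of_nonneg hft]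
    calc (1 + t) ^ (-(m + 2)) * f t ≤ (1 + t) ^ (-(m + 2)) * (c * (1 + t) ^ m) := by
          gcongr
          exact hgrow t ht1.le
      _ = c * (1 + t) ^ (-2 : ℝ) := by
          rw [mul_left_comm, ← Real.rpow_add hpos]
          ring_nf
      _ ≤ c * t ^ (-2 : ℝ) := by
          refine mul_le_mul_of_nonneg_left ?_ hc.le
          exact Real.rpow_le_rpow_of_nonpos (by linarith) (by linarith) (by norm_num)

/-- Since (1 + s)(1 + T - s) ≤ (1 + T)², doubling the exponent lets the weight be distributed over
both factors, whose convolution is integrable. -/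
theorem exists_integrableOn_rpow_mul_selfConv :
    ∃ M : ℝ, 0 ≤ M ∧ IntegrableOn (fun t => (1 + t) ^ (-M) * selfConv f t) (Set.Ioi 0) := by
  obtain ⟨M, hM0, hM⟩ := hF.exists_integrableOn_rpow_mul
  refine ⟨2 * M, by linarith, ?_⟩
  refine Integrable.mono' (integrableOn_selfConv_integral hM) ?_ ?_
  · refine AEStronglyMeasurable.mul ?_ hF.aestronglyMeasurable_selfConv
    exact (by fun_prop : Measurable fun t : ℝ => (1 + t) ^ (-(2 * M))).aestronglyMeasurable
  refine (ae_restrict_iff' measurableSet_Ioi).2 (ae_of_all _ fun T hT => ?_)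
  have hT' : 0 < T := hT
  have h0 := selfConv_nonneg hF.nonneg_right hT'
  have hpos : 0 ≤ (1 + T) ^ (-(2 * M)) := Real.rpow_nonneg (by linarith) _
  rw [Real.norm_eq_abs, abs_of_nonneg (mul_nonneg hpos h0)]
  set g : ℝ → ℝ := fun t => (1 + t) ^ (-M) * f t with hg
  have hgn : ∀ t, 0 < t → 0 ≤ g t := fun t ht =>
    mul_nonneg (Real.rpow_nonneg (by linarith) _) (hF.nonneg_right t ht)
  by_cases hint : IntegrableOn (fun s => f s * f (T - s)) (Set.Ioo 0 T)
  · rw [selfConv, intervalIntegral.integral_of_le hT'.le, intervalIntegral.integral_of_le hT'.le,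
      integral_Ioc_eq_integral_Ioo, integral_Ioc_eq_integral_Ioo, ← integral_const_mul]
    have hgg : ∀ s, g s * g (T - s) = ((1 + s) ^ (-M) * (1 + (T - s)) ^ (-M)) *
        (f s * f (T - s)) := fun s => by simp only [hg]; ring
    have hint2 : IntegrableOn (fun s => g s * g (T - s)) (Set.Ioo 0 T) := by
      simp_rw [hgg]
      refine Integrable.bdd_mul (c := 1) hint ?_ ?_
      · exact (by fun_prop : Measurable fun s : ℝ =>
          (1 + s) ^ (-M) * (1 + (T - s)) ^ (-M)).aestronglyMeasurable
      · refine (ae_restrict_iff' measurableSet_Ioo).2 (ae_of_all _ fun s hs => ?_)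
        have a1 : 0 ≤ (1 + s) ^ (-M) := Real.rpow_nonneg (by linarith [hs.1]) _
        have a2 : 0 ≤ (1 + (T - s)) ^ (-M) := Real.rpow_nonneg (by linarith [hs.2]) _
        rw [Real.norm_eq_abs, abs_of_nonneg (mul_nonneg a1 a2)]
        exact mul_le_one₀ (Real.rpow_le_one_of_one_le_of_nonpos (by linarith [hs.1]) (by linarith))
          a2 (Real.rpow_le_one_of_one_le_of_nonpos (by linarith [hs.2]) (by linarith))
    refine setIntegral_mono_on (hint.const_mul _) hint2 measurableSet_Ioo fun s hs => ?_
    rw [hgg]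
    refine mul_le_mul_of_nonneg_right ?_
      (mul_nonneg (hF.nonneg_right s hs.1) (hF.nonneg_right _ (sub_pos.2 hs.2)))
    have p1 : 0 < 1 + s := by linarith [hs.1]
    have p2 : 0 < 1 + (T - s) := by linarith [hs.2]
    have e : (1 + T) ^ (-(2 * M)) = ((1 + T) ^ 2) ^ (-M) := by
      rw [← Real.rpow_natCast, ← Real.rpow_mul (by linarith)]
      congr 1
      push_cast
      ring
    rw [e, ← Real.mul_rpow p1.le p2.le]
    refine Real.rpow_le_rpow_of_nonpos (by positivity) ?_ (by linarith)
    nlinarith [hs.1, hs.2]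
  -- If the convolution integral diverges at T, its default value 0 makes the bound trivial.
  · have hz : selfConv f T = 0 := by
      rw [selfConv, intervalIntegral.integral_of_le hT'.le, integral_Ioc_eq_integral_Ioo]
      exact integral_undef hint
    rw [hz, mul_zero, intervalIntegral.integral_of_le hT'.le, integral_Ioc_eq_integral_Ioo]
    exact setIntegral_nonneg measurableSet_Ioo fun s hs =>
      mul_nonneg (hgn s hs.1) (hgn _ (sub_pos.2 hs.2))

end IsPolyLaplace

end laplace

/-! ### Laplace transforms of random variables. -/

section rvLaplace

variable {Ω : Type*} [mΩ : MeasurableSpace Ω] {P : Measure Ω} {X : Ω → ℝ}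

theorem rvLaplace_nonneg (t : ℝ) : 0 ≤ rvLaplace P X t :=
  integral_nonneg fun _ => (Real.exp_pos _).le

theorem rvLaplace_add_const (a t : ℝ) :
    rvLaplace P (fun w => X w + a) t = Real.exp (-a * t) * rvLaplace P X t := by
  rw [rvLaplace, rvLaplace, ← integral_const_mul]
  congr 1 with w
  rw [← Real.exp_add]
  ring_nf

theorem exp_neg_mul_le_one_ae (h0 : ∀ᵐ w ∂P, 0 ≤ X w) {t : ℝ} (ht : 0 ≤ t) :
    ∀ᵐ w ∂P, Real.exp (-t * X w) ≤ 1 := by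
  filter_upwards [h0] with w hw
  exact Real.exp_le_one_iff.2 (by nlinarith)

variable [IsProbabilityMeasure P]

theorem measurable_rvLaplace (hX : Measurable X) : Measurable (rvLaplace P X) := by
  have hm : StronglyMeasurable (Function.uncurry fun (t : ℝ) (w : Ω) => Real.exp (-t * X w)) := by
    refine Measurable.stronglyMeasurable ?_
    fun_prop
  exact hm.integral_prod_right.measurable

theorem integrable_exp_neg_mul (hX : Measurable X) (h0 : ∀ᵐ w ∂P, 0 ≤ X w) {t : ℝ} (ht : 0 ≤ t) :
    Integrable (fun w => Real.exp (-t * X w)) P := by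
  refine Integrable.of_bound (by fun_prop) 1 ?_
  filter_upwards [exp_neg_mul_le_one_ae h0 ht] with w hw
  rwa [Real.norm_eq_abs, abs_of_pos (Real.exp_pos _)]

theorem rvLaplace_le_one (hX : Measurable X) (h0 : ∀ᵐ w ∂P, 0 ≤ X w) {t : ℝ} (ht : 0 ≤ t) :
    rvLaplace P X t ≤ 1 := by
  have := integral_mono_ae (integrable_exp_neg_mul hX h0 ht) (integrable_const 1)
    (exp_neg_mul_le_one_ae h0 ht)
  simpa [rvLaplace] using this

/-- A nonnegative random variable whose Laplace transform vanishes at infinity is positive. -/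
theorem ae_pos_of_rvLaplace_le (hX : Measurable X) (h0 : ∀ᵐ w ∂P, 0 ≤ X w) {c β : ℝ} (hβ : 0 < β)
    (h : ∀ t : ℝ, 0 ≤ t → rvLaplace P X t ≤ c * (1 + t) ^ (-β)) : ∀ᵐ w ∂P, 0 < X w := by
  have hs : MeasurableSet {w | X w ≤ 0} := measurableSet_le hX measurable_const
  -- Markov's inequality: e^{-tX} is at least 1 where X ≤ 0.
  have hle : ∀ t : ℝ, 0 ≤ t → P.real {w | X w ≤ 0} ≤ c * (1 + t) ^ (-β) := fun t ht => by
    refine le_trans ?_ (h t ht)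
    rw [← integral_indicator_one hs]
    refine integral_mono_ae ((integrable_const 1).indicator hs) (integrable_exp_neg_mul hX h0 ht)
      (ae_of_all _ fun w => ?_)
    by_cases hw : w ∈ {w | X w ≤ 0}
    · rw [Set.indicator_of_mem hw]
      have hw' : X w ≤ 0 := hw
      exact Real.one_le_exp (by nlinarith)
    · rw [Set.indicator_of_notMem hw]
      exact (Real.exp_pos _).le
  have hlim : Tendsto (fun t : ℝ => c * (1 + t) ^ (-β)) atTop (𝓝 0) := by
    have := ((tendsto_rpow_neg_atTop hβ).comp
      (tendsto_atTop_add_const_left atTop (1 : ℝ) tendsto_id)).const_mul c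
    simpa using this
  have hz : P.real {w | X w ≤ 0} ≤ 0 :=
    ge_of_tendsto hlim ((eventually_ge_atTop 0).mono fun t ht => hle t ht)
  have hz' : P {w | X w ≤ 0} = 0 :=
    (measureReal_eq_zero_iff).1 (le_antisymm hz measureReal_nonneg)
  rw [ae_iff]
  simpa only [not_lt] using hz'

/-- The second moment of `F (W)` for the Laplace transform `F` of `f`, in terms of the Laplace
transform of `W`. -/
theorem IsPolyLaplace.integral_sq_comp {F f : ℝ → ℝ} (hF : IsPolyLaplace F f) (hX : Measurable X)
    (hpos : ∀ᵐ w ∂P, 0 < X w)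
    (hint : IntegrableOn (fun t => selfConv f t * rvLaplace P X t) (Set.Ioi 0)) :
    MemLp (fun w => laplaceTransform f (X w)) 2 P ∧
      ∫ w, laplaceTransform f (X w) ^ 2 ∂P
        = ∫ t in Set.Ioi 0, selfConv f t * rvLaplace P X t := by
  have h0 : ∀ᵐ w ∂P, 0 ≤ X w := hpos.mono fun w hw => hw.le
  have hGm : AEStronglyMeasurable (fun z : Ω × ℝ => Real.exp (-X z.1 * z.2) * selfConv f z.2)
      (P.prod (volume.restrict (Set.Ioi 0))) :=
    AEStronglyMeasurable.mul (by fun_prop) hF.aestronglyMeasurable_selfConv.comp_snd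
  have hL : ∀ t, ∫ w, Real.exp (-X w * t) * selfConv f t ∂P = selfConv f t * rvLaplace P X t :=
    fun t => by
      rw [integral_mul_const, mul_comm, rvLaplace]
      congr 2 with w
      ring_nf
  -- The integrand is nonnegative for t > 0, so integrability on the product is that of the iterated
  -- integral, which is `hint`.
  have hG : Integrable (fun z : Ω × ℝ => Real.exp (-X z.1 * z.2) * selfConv f z.2)
      (P.prod (volume.restrict (Set.Ioi 0))) := by
    rw [integrable_prod_iff' hGm]
    constructor
    · refine (ae_restrict_iff' measurableSet_Ioi).2 (ae_of_all _ fun t ht => ?_)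
      refine ((integrable_exp_neg_mul hX h0 (le_of_lt ht)).mul_const (selfConv f t)).congr
        (ae_of_all _ fun w => ?_)
      ring_nf
    · refine hint.congr_fun (fun t ht => ?_) measurableSet_Ioi
      simp only
      rw [← hL]
      congr 1 with w
      rw [Real.norm_eq_abs, abs_of_nonneg]
      exact mul_nonneg (Real.exp_pos _).le (selfConv_nonneg hF.nonneg_right ht)
  have hae : (fun w => ∫ t in Set.Ioi 0, Real.exp (-X w * t) * selfConv f t)
      =ᵐ[P] fun w => laplaceTransform f (X w) ^ 2 := by
    filter_upwards [hpos] with w hw using hF.integral_exp_mul_selfConv hw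
  constructor
  · refine (memLp_two_iff_integrable_sq
      (hF.measurable_laplaceTransform.comp hX).aestronglyMeasurable).2 ?_
    exact hG.integral_prod_left.congr hae
  · rw [← integral_congr_ae hae, integral_integral_swap hG]
    simp_rw [hL]

end rvLaplace

/-! ### Weights and noise. -/

/-- Nonnegative weights of total mass `1` with geometric decay. -/
structure IsDecayingWeight (lam : ℕ → ℝ) (γ : ℝ) : Prop where
  nonneg : ∀ n, 0 ≤ lam n
  hasSum : HasSum lam 1
  mem_Ioo : γ ∈ Set.Ioo (0 : ℝ) 1
  decay : BddAbove (Set.range fun n : ℕ => (γ ^ n)⁻¹ * lam n)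

/-- The mass `∑_{j ≥ n} λ_j` of the weights not yet used at time `n`. -/
noncomputable def tailWeight (lam : ℕ → ℝ) (n : ℕ) : ℝ := 1 - ∑ j ∈ Finset.range n, lam j

namespace IsDecayingWeight

variable {lam : ℕ → ℝ} {γ : ℝ} (hlam : IsDecayingWeight lam γ)
include hlam

theorem tailWeight_nonneg (n : ℕ) : 0 ≤ tailWeight lam n :=
  sub_nonneg.2 (sum_le_hasSum _ (fun i _ => hlam.nonneg i) hlam.hasSum)

theorem tailWeight_anti {m n : ℕ} (h : m ≤ n) : tailWeight lam n ≤ tailWeight lam m :=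
  sub_le_sub_left (Finset.sum_le_sum_of_subset_of_nonneg (Finset.range_mono h)
    fun i _ _ => hlam.nonneg i) _

theorem tendsto_tailWeight : Tendsto (tailWeight lam) atTop (𝓝 0) := by
  have := hlam.hasSum.tendsto_sum_nat.const_sub 1
  rwa [sub_self] at this

theorem le_one (n : ℕ) : lam n ≤ 1 := by
  simpa using sum_le_hasSum {n} (fun i _ => hlam.nonneg i) hlam.hasSum

theorem eq_zero_of_tailWeight_eq_zero {n j : ℕ} (h : tailWeight lam n = 0) (hj : n ≤ j) :
    lam j = 0 := by
  refine le_antisymm ?_ (hlam.nonneg j)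
  have h1 := sum_le_hasSum (insert j (Finset.range n)) (fun i _ => hlam.nonneg i) hlam.hasSum
  rw [Finset.sum_insert (by simpa using hj)] at h1
  rw [tailWeight] at h
  linarith

theorem finite_support_of_tailWeight_eq_zero {n : ℕ} (h : tailWeight lam n = 0) :
    (Function.support lam).Finite := by
  refine (Finset.range n).finite_toSet.subset fun j hj => ?_
  by_contra hjn
  exact hj (hlam.eq_zero_of_tailWeight_eq_zero h (by simpa using hjn))

theorem tailWeight_eq_zero {n : ℕ} (h : ∀ j, n ≤ j → lam j = 0) : tailWeight lam n = 0 := by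
  have h1 : HasSum lam (∑ j ∈ Finset.range n, lam j) :=
    hasSum_sum_of_ne_finset_zero fun j hj => h j (by simpa using hj)
  rw [tailWeight, h1.unique hlam.hasSum, sub_self]

/-- Powers preserve geometric decay, with ratio γ^α < 1. This sum controls both the infinite product
of Laplace transforms and the mixing rate. -/
theorem summable_rpow {α : ℝ} (hα : 0 < α) : Summable fun n => lam n ^ α := by
  obtain ⟨C, hC⟩ := hlam.decay
  have hγ0 := hlam.mem_Ioo.1
  have hle : ∀ n, lam n ≤ C * γ ^ n := fun n => by
    have h1 : (γ ^ n)⁻¹ * lam n ≤ C := hC ⟨n, rfl⟩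
    rwa [inv_mul_le_iff₀ (pow_pos hγ0 n), mul_comm] at h1
  have hC0 : 0 ≤ C := by
    have := hle 0
    simp only [pow_zero, mul_one] at this
    exact (hlam.nonneg 0).trans this
  have hg : Summable fun n : ℕ => C ^ α * (γ ^ α) ^ n :=
    (summable_geometric_of_lt_one (Real.rpow_nonneg hγ0.le _)
      (Real.rpow_lt_one hγ0.le hlam.mem_Ioo.2 hα)).mul_left _
  refine Summable.of_nonneg_of_le (fun n => Real.rpow_nonneg (hlam.nonneg n) _) (fun n => ?_) hg
  calc lam n ^ α ≤ (C * γ ^ n) ^ α := Real.rpow_le_rpow (hlam.nonneg n) (hle n) hα.le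
    _ = C ^ α * (γ ^ α) ^ n := by
      rw [Real.mul_rpow hC0 (pow_nonneg hγ0.le n), ← Real.rpow_natCast, ← Real.rpow_natCast,
        ← Real.rpow_mul hγ0.le, ← Real.rpow_mul hγ0.le, mul_comm α]

end IsDecayingWeight

/-- I.i.d. nonnegative random variables `ξ 1, ξ 2, …` with two-sided bounds on the Laplace
transform. -/
structure IsLaplaceNoise {Ω : Type*} [MeasurableSpace Ω] (P : Measure Ω) (ξ : ℕ → Ω → ℝ)
    (α β c : ℝ) : Prop where
  meas : ∀ n, 1 ≤ n → Measurable (ξ n)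
  nonneg : ∀ n, 1 ≤ n → ∀ᵐ w ∂P, 0 ≤ ξ n w
  indep : iIndepFun (fun n : ℕ => ξ (n + 1)) P
  ident : ∀ n, 1 ≤ n → IdentDistrib (ξ n) (ξ 1) P P
  exponent_pos : 0 < α
  decay_pos : 0 < β
  const_pos : 0 < c
  lower : ∀ t : ℝ, 0 ≤ t → 1 - t ^ α ≤ rvLaplace P (ξ 1) t
  upper : ∀ t : ℝ, 0 ≤ t → rvLaplace P (ξ 1) t ≤ c * (1 + t) ^ (-β)

/-- Zero-based form, matching the indexing of the independence hypothesis. The truncated subtraction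
is harmless since i < n. -/
theorem movingAverage_eq {Ω : Type*} (lam : ℕ → ℝ) (ω₀ : ℝ) (ξ : ℕ → Ω → ℝ) (n : ℕ) (w : Ω) :
    movingAverage lam ω₀ ξ n w = tailWeight lam n * ω₀
      + ∑ i ∈ Finset.range n, lam (n - 1 - i) * ξ (i + 1) w := by
  have hI : Finset.Icc 1 n = Finset.Ico 1 (n + 1) := by
    ext k
    simp
  rw [movingAverage, hI, Finset.sum_Ico_eq_sum_range, Finset.sum_Ico_eq_sum_range,
    Nat.add_sub_cancel, tailWeight, ← Finset.sum_range_reflect lam n]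
  simp_rw [Nat.sub_sub, Nat.add_comm]

/-! ### Laplace transform of the moving average. -/

section movingAverage

variable {Ω : Type*} [mΩ : MeasurableSpace Ω] {P : Measure Ω}
  {ξ : ℕ → Ω → ℝ} {α β c : ℝ} {lam : ℕ → ℝ} {γ : ℝ}

variable (hξ : IsLaplaceNoise P ξ α β c) (hlam : IsDecayingWeight lam γ)

namespace IsLaplaceNoise

include hξ

theorem measurable_movingAverage (ω₀ : ℝ) (n : ℕ) : Measurable (movingAverage lam ω₀ ξ n) := by
  have : movingAverage lam ω₀ ξ n = fun w => tailWeight lam n * ω₀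
      + ∑ i ∈ Finset.range n, lam (n - 1 - i) * ξ (i + 1) w := by
    ext w
    exact movingAverage_eq lam ω₀ ξ n w
  rw [this]
  exact (Finset.measurable_fun_sum _ fun i _ => (hξ.meas (i + 1) (by omega)).const_mul _).const_add _

/-- Independence factors the transform. As the noise is identically distributed, reversing the order
of the weights turns the product into a partial product of the infinite one. -/
theorem rvLaplace_movingAverage (ω₀ : ℝ) (n : ℕ) (t : ℝ) :
    rvLaplace P (movingAverage lam ω₀ ξ n) t = Real.exp (-(tailWeight lam n * ω₀) * t) *
      ∏ j ∈ Finset.range n, rvLaplace P (ξ 1) (lam j * t) := by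
  have h1 : movingAverage lam ω₀ ξ n = fun w =>
      (∑ i ∈ Finset.range n, lam (n - 1 - i) * ξ (i + 1) w) + tailWeight lam n * ω₀ := by
    ext w
    rw [movingAverage_eq, add_comm]
  rw [h1, rvLaplace_add_const]
  congr 1
  have hind : iIndepFun (fun i : ℕ => fun w => lam (n - 1 - i) * ξ (i + 1) w) P :=
    hξ.indep.comp (fun i x => lam (n - 1 - i) * x) fun i => by fun_prop
  have h2 := hind.mgf_sum (t := -t)
    (fun i => (hξ.meas (i + 1) (by omega)).const_mul _) (Finset.range n)
  have h3 : rvLaplace P (fun w => ∑ i ∈ Finset.range n, lam (n - 1 - i) * ξ (i + 1) w) t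
      = mgf (∑ i ∈ Finset.range n, fun w => lam (n - 1 - i) * ξ (i + 1) w) P (-t) := by
    rw [rvLaplace, mgf]
    simp only [Finset.sum_apply]
  rw [h3, h2, ← Finset.prod_range_reflect (fun j => rvLaplace P (ξ 1) (lam j * t))]
  refine Finset.prod_congr rfl fun i _ => ?_
  rw [mgf_const_mul, mgf_congr_identDistrib (hξ.ident (i + 1) (by omega)), rvLaplace, mgf]
  congr 1 with w
  ring_nf

variable [IsProbabilityMeasure P]

theorem rvLaplace_le_one {t : ℝ} (ht : 0 ≤ t) : rvLaplace P (ξ 1) t ≤ 1 :=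
  _root_.rvLaplace_le_one (hξ.meas 1 le_rfl) (hξ.nonneg 1 le_rfl) ht

theorem ae_pos : ∀ᵐ w ∂P, ∀ i : ℕ, 0 < ξ (i + 1) w := by
  rw [ae_all_iff]
  intro i
  have h1 := ae_pos_of_rvLaplace_le (hξ.meas 1 le_rfl) (hξ.nonneg 1 le_rfl) hξ.decay_pos hξ.upper
  exact ((hξ.ident (i + 1) (by omega)).symm.ae_snd measurableSet_Ioi h1)

include hlam

/-- Either mass is left over and multiplies ω₀ > 0, or the weights used sum to 1, so one of them is
positive and multiplies an almost surely positive ξ. -/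
theorem ae_movingAverage_pos {ω₀ : ℝ} (hω₀ : 0 < ω₀) (n : ℕ) :
    ∀ᵐ w ∂P, 0 < movingAverage lam ω₀ ξ n w := by
  filter_upwards [hξ.ae_pos] with w hw
  rw [movingAverage_eq]
  have hterm : ∀ i ∈ Finset.range n, 0 ≤ lam (n - 1 - i) * ξ (i + 1) w := fun i _ =>
    mul_nonneg (hlam.nonneg _) (hw i).le
  rcases (hlam.tailWeight_nonneg n).eq_or_lt with h | h
  · rw [← h, zero_mul, zero_add]
    refine Finset.sum_pos' hterm ?_
    by_contra! hcon
    have hz : ∀ j ∈ Finset.range n, lam j = 0 := fun j hj => by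
      have hjn := Finset.mem_range.1 hj
      have h1 := hcon (n - 1 - j) (Finset.mem_range.2 (by omega))
      rw [show n - 1 - (n - 1 - j) = j by omega] at h1
      refine le_antisymm ?_ (hlam.nonneg j)
      by_contra! h2
      exact absurd h1 (not_le.2 (mul_pos h2 (hw _)))
    rw [tailWeight, Finset.sum_eq_zero hz] at h
    norm_num at h
  · exact add_pos_of_pos_of_nonneg (mul_pos h hω₀) (Finset.sum_nonneg hterm)

/-- The lower bound on φ gives 0 ≤ 1 - φ(λ_j t) ≤ λ_j^α t^α, which is summable. -/
theorem multipliable_rvLaplace {t : ℝ} (ht : 0 ≤ t) :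
    Multipliable fun j => rvLaplace P (ξ 1) (lam j * t) := by
  have h := multipliable_one_add_of_summable (f := fun j => rvLaplace P (ξ 1) (lam j * t) - 1) ?_
  · simpa using h
  refine Summable.of_nonneg_of_le (fun j => norm_nonneg _) (fun j => ?_)
    ((hlam.summable_rpow hξ.exponent_pos).mul_right (t ^ α))
  have hjt : 0 ≤ lam j * t := mul_nonneg (hlam.nonneg j) ht
  have h1 := hξ.rvLaplace_le_one hjt
  have h2 := hξ.lower _ hjt
  rw [Real.norm_eq_abs, abs_sub_comm, abs_of_nonneg (by linarith),
    ← Real.mul_rpow (hlam.nonneg j) ht]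
  linarith

theorem tendsto_rvLaplace_movingAverage (ω₀ : ℝ) {t : ℝ} (ht : 0 ≤ t) :
    Tendsto (fun n => rvLaplace P (movingAverage lam ω₀ ξ n) t) atTop
      (𝓝 (∏' j, rvLaplace P (ξ 1) (lam j * t))) := by
  simp_rw [hξ.rvLaplace_movingAverage]
  have h1 : Tendsto (fun n => Real.exp (-(tailWeight lam n * ω₀) * t)) atTop (𝓝 1) := by
    have := (((hlam.tendsto_tailWeight.mul_const ω₀).neg).mul_const t).rexp
    simpa using this
  have h2 := h1.mul (hξ.multipliable_rvLaplace hlam ht).hasProd.tendsto_prod_nat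
  rwa [one_mul] at h2

theorem rvLaplace_movingAverage_eq_tprod (ω₀ : ℝ) {n : ℕ} (hn : tailWeight lam n = 0) (t : ℝ) :
    rvLaplace P (movingAverage lam ω₀ ξ n) t = ∏' j, rvLaplace P (ξ 1) (lam j * t) := by
  rw [hξ.rvLaplace_movingAverage, hn, tprod_eq_prod (s := Finset.range n)]
  · simp
  · intro j hj
    rw [hlam.eq_zero_of_tailWeight_eq_zero hn (by simpa using hj)]
    simp [rvLaplace]

theorem rvLaplace_movingAverage_le_exp (ω₀ : ℝ) (n : ℕ) {t : ℝ} (ht : 0 ≤ t) :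
    rvLaplace P (movingAverage lam ω₀ ξ n) t ≤ Real.exp (-(tailWeight lam n * ω₀) * t) := by
  rw [hξ.rvLaplace_movingAverage]
  refine mul_le_of_le_one_right (Real.exp_pos _).le (Finset.prod_le_one
    (fun j _ => rvLaplace_nonneg _) fun j _ => hξ.rvLaplace_le_one (mul_nonneg (hlam.nonneg j) ht))

/-- With infinitely many weights, the Laplace transform of the moving average decays faster than
any given power, uniformly from some time on. -/
theorem exists_rvLaplace_movingAverage_le {ω₀ : ℝ} (hω₀ : 0 < ω₀)
    (hinf : (Function.support lam).Infinite) (M : ℝ) :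
    ∃ n₀ : ℕ, ∃ D : ℝ, 0 ≤ D ∧ ∀ n, n₀ ≤ n → ∀ t : ℝ, 0 ≤ t →
      rvLaplace P (movingAverage lam ω₀ ξ n) t ≤ D * (1 + t) ^ (-M) := by
  -- Each positive weight contributes a decay of order β, so L of them with βL ≥ M suffice.
  obtain ⟨L, hL⟩ := exists_nat_ge (M / β)
  obtain ⟨J, hJ, hJL⟩ := hinf.exists_subset_card_eq L
  have hpos : ∀ j ∈ J, 0 < lam j := fun j hj =>
    lt_of_le_of_ne (hlam.nonneg j) (Ne.symm (hJ hj))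
  refine ⟨J.sup id + 1, ∏ j ∈ J, (c * lam j ^ (-β)), Finset.prod_nonneg fun j hj =>
    mul_nonneg hξ.const_pos.le (Real.rpow_nonneg (hpos j hj).le _), fun n hn t ht => ?_⟩
  have hsub : J ⊆ Finset.range n := fun j hj => by
    have : j ≤ J.sup id := Finset.le_sup (f := id) hj
    exact Finset.mem_range.2 (by omega)
  have hfac0 : ∀ j, 0 ≤ lam j * t := fun j => mul_nonneg (hlam.nonneg j) ht
  have ht1 : 0 < 1 + t := by linarith
  rw [hξ.rvLaplace_movingAverage]
  calc Real.exp (-(tailWeight lam n * ω₀) * t) *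
        ∏ j ∈ Finset.range n, rvLaplace P (ξ 1) (lam j * t)
      ≤ 1 * ∏ j ∈ Finset.range n, rvLaplace P (ξ 1) (lam j * t) := by
        refine mul_le_mul_of_nonneg_right (Real.exp_le_one_iff.2 ?_)
          (Finset.prod_nonneg fun j _ => rvLaplace_nonneg _)
        rw [neg_mul, neg_nonpos]
        exact mul_nonneg (mul_nonneg (hlam.tailWeight_nonneg n) hω₀.le) ht
    _ ≤ ∏ j ∈ J, rvLaplace P (ξ 1) (lam j * t) := by
        rw [one_mul]
        exact Finset.prod_le_prod_of_subset_of_le_one hsub (fun j _ => rvLaplace_nonneg _)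
          fun j _ _ => hξ.rvLaplace_le_one (hfac0 j)
    _ ≤ ∏ j ∈ J, (c * lam j ^ (-β)) * (1 + t) ^ (-β) := by
        refine Finset.prod_le_prod (fun j _ => rvLaplace_nonneg _) fun j hj => ?_
        refine (hξ.upper _ (hfac0 j)).trans ?_
        -- As λ_j ≤ 1, λ_j (1 + t) ≤ 1 + λ_j t.
        rw [mul_assoc, ← Real.mul_rpow (hpos j hj).le ht1.le]
        refine mul_le_mul_of_nonneg_left ?_ hξ.const_pos.le
        refine Real.rpow_le_rpow_of_nonpos (mul_pos (hpos j hj) ht1) ?_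
          (neg_nonpos.2 hξ.decay_pos.le)
        nlinarith [hlam.le_one j]
    _ = (∏ j ∈ J, (c * lam j ^ (-β))) * (1 + t) ^ (-(β * L)) := by
        rw [Finset.prod_mul_distrib, Finset.prod_const, hJL, ← Real.rpow_natCast,
          ← Real.rpow_mul ht1.le, neg_mul]
    _ ≤ _ := by
        refine mul_le_mul_of_nonneg_left ?_ (Finset.prod_nonneg fun j hj =>
          mul_nonneg hξ.const_pos.le (Real.rpow_nonneg (hpos j hj).le _))
        refine Real.rpow_le_rpow_of_exponent_le (by linarith) (neg_le_neg ?_)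
        rw [div_le_iff₀ hξ.decay_pos] at hL
        linarith

end IsLaplaceNoise

end movingAverage

/-- Expand (1 - e^{-a})(1 - e^{-b}) ≥ 0. The bounded quantity 1 - e^{-r} measures smallness without
requiring the noise to have a mean. -/
theorem one_sub_exp_neg_add_le {a b : ℝ} (ha : 0 ≤ a) (hb : 0 ≤ b) :
    1 - Real.exp (-(a + b)) ≤ (1 - Real.exp (-a)) + (1 - Real.exp (-b)) := by
  have h1 : Real.exp (-a) ≤ 1 := Real.exp_le_one_iff.2 (by linarith)
  have h2 : Real.exp (-b) ≤ 1 := Real.exp_le_one_iff.2 (by linarith)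
  rw [neg_add, Real.exp_add]
  nlinarith

theorem one_sub_exp_neg_sum_le {ι : Type*} (s : Finset ι) {r : ι → ℝ} (hr : ∀ i, 0 ≤ r i) :
    1 - Real.exp (-∑ i ∈ s, r i) ≤ ∑ i ∈ s, (1 - Real.exp (-r i)) := by
  classical
  induction s using Finset.induction_on with
  | empty => simp
  | insert i s hi ih =>
    rw [Finset.sum_insert hi, Finset.sum_insert hi]
    have := one_sub_exp_neg_add_le (hr i) (Finset.sum_nonneg fun j (_ : j ∈ s) => hr j)
    linarith

/-! ### Second moments and the limiting variance. -/

section variance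

variable {Ω : Type*} [mΩ : MeasurableSpace Ω] {P : Measure Ω}
  {ξ : ℕ → Ω → ℝ} {α β c : ℝ} {lam : ℕ → ℝ} {γ : ℝ} {F f : ℝ → ℝ} {ω₀ : ℝ}

theorem varianceIntegrand_nonneg (hF : IsPolyLaplace F f) {t : ℝ} (ht : 0 < t)
    (hm : Multipliable fun j => rvLaplace P (ξ 1) (lam j * t)) :
    0 ≤ varianceIntegrand f (rvLaplace P (ξ 1)) lam t :=
  mul_nonneg (selfConv_nonneg hF.nonneg_right ht)
    (ge_of_tendsto' hm.hasProd.tendsto_prod_nat fun _ =>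
      Finset.prod_nonneg fun _ _ => rvLaplace_nonneg _)

variable [IsProbabilityMeasure P]

namespace IsLaplaceNoise

variable (hξ : IsLaplaceNoise P ξ α β c) (hlam : IsDecayingWeight lam γ) (hF : IsPolyLaplace F f)
  (hω₀ : 0 < ω₀)
include hξ hlam

include hF

theorem tendsto_integral_exp_mul_varianceIntegrand
    (hV : IntegrableOn (varianceIntegrand f (rvLaplace P (ξ 1)) lam) (Set.Ioi 0)) :
    Tendsto (fun ε : ℝ => ∫ t in Set.Ioi 0,
        Real.exp (-ε * t) * varianceIntegrand f (rvLaplace P (ξ 1)) lam t) (𝓝[>] 0)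
      (𝓝 (limitVariance f (rvLaplace P (ξ 1)) lam)) := by
  refine tendsto_integral_filter_of_dominated_convergence
    (varianceIntegrand f (rvLaplace P (ξ 1)) lam) ?_ ?_ hV ?_
  · exact Eventually.of_forall fun ε => AEStronglyMeasurable.mul (by fun_prop)
      hV.aestronglyMeasurable
  · filter_upwards [self_mem_nhdsWithin] with ε hε
    refine (ae_restrict_iff' measurableSet_Ioi).2 (ae_of_all _ fun t ht => ?_)
    have hε' : 0 < ε := hε
    have ht' : 0 < t := ht
    have h0 := varianceIntegrand_nonneg hF ht (hξ.multipliable_rvLaplace hlam (le_of_lt ht))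
    rw [norm_mul, Real.norm_eq_abs, Real.norm_eq_abs, abs_of_pos (Real.exp_pos _),
      abs_of_nonneg h0]
    exact mul_le_of_le_one_left h0 (Real.exp_le_one_iff.2 (by nlinarith))
  · refine ae_of_all _ fun t => ?_
    have h1 : Tendsto (fun ε : ℝ => Real.exp (-ε * t)) (𝓝[>] 0) (𝓝 (Real.exp (-0 * t))) :=
      ((by fun_prop : Continuous fun ε : ℝ => Real.exp (-ε * t)).tendsto 0).mono_left
        nhdsWithin_le_nhds
    have h2 := h1.mul_const (varianceIntegrand f (rvLaplace P (ξ 1)) lam t)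
    simpa using h2

include hω₀

/-- If mass is left over, the constant part keeps ω_n away from 0 and gives exponential decay.
Otherwise the support is finite and the integrand is already the limiting one. -/
theorem integrableOn_selfConv_mul_rvLaplace
    (hfin : (Function.support lam).Finite →
      IntegrableOn (varianceIntegrand f (rvLaplace P (ξ 1)) lam) (Set.Ioi 0)) (n : ℕ) :
    IntegrableOn (fun t => selfConv f t * rvLaplace P (movingAverage lam ω₀ ξ n) t)
      (Set.Ioi 0) := by
  rcases (hlam.tailWeight_nonneg n).eq_or_lt with h | h
  · refine (hfin (hlam.finite_support_of_tailWeight_eq_zero h.symm)).congr_fun (fun t ht => ?_)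
      measurableSet_Ioi
    rw [varianceIntegrand, hξ.rvLaplace_movingAverage_eq_tprod hlam ω₀ h.symm]
  · refine Integrable.mono' (hF.integrableOn_exp_mul_selfConv (mul_pos h hω₀))
      (hF.aestronglyMeasurable_selfConv.mul
        (measurable_rvLaplace (hξ.measurable_movingAverage ω₀ n)).aestronglyMeasurable)
      ((ae_restrict_iff' measurableSet_Ioi).2 (ae_of_all _ fun t ht => ?_))
    have h0 := selfConv_nonneg hF.nonneg_right ht
    rw [Real.norm_eq_abs, abs_of_nonneg (mul_nonneg h0 (rvLaplace_nonneg _)), mul_comm]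
    exact mul_le_mul_of_nonneg_right
      (hξ.rvLaplace_movingAverage_le_exp hlam ω₀ n (le_of_lt ht)) h0

/-- With finite support the integrand eventually equals its limit; with infinite support, decay of
arbitrary polynomial order beats the growth of f∗f. -/
theorem exists_integrableOn_bound
    (hfin : (Function.support lam).Finite →
      IntegrableOn (varianceIntegrand f (rvLaplace P (ξ 1)) lam) (Set.Ioi 0)) :
    ∃ n₀ : ℕ, ∃ b : ℝ → ℝ, IntegrableOn b (Set.Ioi 0) ∧ ∀ n, n₀ ≤ n → ∀ t : ℝ, 0 < t →
      selfConv f t * rvLaplace P (movingAverage lam ω₀ ξ n) t ≤ b t := by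
  by_cases hs : (Function.support lam).Finite
  · refine ⟨hs.toFinset.sup id + 1, _, hfin hs, fun n hn t ht => ?_⟩
    rw [varianceIntegrand, hξ.rvLaplace_movingAverage_eq_tprod hlam ω₀]
    refine hlam.tailWeight_eq_zero fun j hj => ?_
    by_contra hne
    have : j ≤ hs.toFinset.sup id := Finset.le_sup (f := id) (hs.mem_toFinset.2 hne)
    omega
  · obtain ⟨M, -, hM⟩ := hF.exists_integrableOn_rpow_mul_selfConv
    obtain ⟨n₀, D, hD, hbound⟩ := hξ.exists_rvLaplace_movingAverage_le hlam hω₀ hs M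
    refine ⟨n₀, _, hM.const_mul D, fun n hn t ht => ?_⟩
    calc _ ≤ selfConv f t * (D * (1 + t) ^ (-M)) := mul_le_mul_of_nonneg_left
          (hbound n hn t ht.le) (selfConv_nonneg hF.nonneg_right ht)
      _ = _ := by ring

theorem integrableOn_varianceIntegrand
    (hfin : (Function.support lam).Finite →
      IntegrableOn (varianceIntegrand f (rvLaplace P (ξ 1)) lam) (Set.Ioi 0)) :
    IntegrableOn (varianceIntegrand f (rvLaplace P (ξ 1)) lam) (Set.Ioi 0) := by
  obtain ⟨n₀, b, hb, hle⟩ := hξ.exists_integrableOn_bound hlam hF hω₀ hfin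
  have hlim : ∀ t : ℝ, 0 < t →
      Tendsto (fun n => selfConv f t * rvLaplace P (movingAverage lam ω₀ ξ n) t) atTop
        (𝓝 (varianceIntegrand f (rvLaplace P (ξ 1)) lam t)) := fun t ht =>
    (hξ.tendsto_rvLaplace_movingAverage hlam ω₀ ht.le).const_mul _
  refine Integrable.mono' hb ?_ ((ae_restrict_iff' measurableSet_Ioi).2 (ae_of_all _ fun t ht => ?_))
  · refine aestronglyMeasurable_of_tendsto_ae atTop (fun n => hF.aestronglyMeasurable_selfConv.mul
      (measurable_rvLaplace (hξ.measurable_movingAverage (lam := lam) ω₀ n)).aestronglyMeasurable)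
      ((ae_restrict_iff' measurableSet_Ioi).2 (ae_of_all _ fun t ht => hlim t ht))
  · rw [Real.norm_eq_abs, abs_of_nonneg
      (varianceIntegrand_nonneg hF ht (hξ.multipliable_rvLaplace hlam (le_of_lt ht)))]
    exact le_of_tendsto (hlim t ht) ((eventually_ge_atTop n₀).mono fun n hn => hle n hn t ht)

/-- Second moments of `F (ω_n + ε)` and their limit. -/
theorem integral_sq_laplaceTransform_movingAverage
    (hfin : (Function.support lam).Finite →
      IntegrableOn (varianceIntegrand f (rvLaplace P (ξ 1)) lam) (Set.Ioi 0))
    {ε : ℝ} (hε : 0 ≤ ε) :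
    (∀ n, MemLp (fun w => laplaceTransform f (movingAverage lam ω₀ ξ n w + ε)) 2 P) ∧
    Tendsto (fun n => ∫ w, laplaceTransform f (movingAverage lam ω₀ ξ n w + ε) ^ 2 ∂P) atTop
      (𝓝 (∫ t in Set.Ioi 0,
        Real.exp (-ε * t) * varianceIntegrand f (rvLaplace P (ξ 1)) lam t)) := by
  have hexp : ∀ t : ℝ, 0 < t → ‖Real.exp (-ε * t)‖ ≤ 1 := fun t ht => by
    rw [Real.norm_eq_abs, abs_of_pos (Real.exp_pos _)]
    exact Real.exp_le_one_iff.2 (by nlinarith)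
  have hint : ∀ n, IntegrableOn (fun t => selfConv f t *
      rvLaplace P (fun w => movingAverage lam ω₀ ξ n w + ε) t) (Set.Ioi 0) := fun n => by
    have h1 := hξ.integrableOn_selfConv_mul_rvLaplace hlam hF hω₀ hfin n
    have h2 : IntegrableOn (fun t => Real.exp (-ε * t) *
        (selfConv f t * rvLaplace P (movingAverage lam ω₀ ξ n) t)) (Set.Ioi 0) :=
      Integrable.bdd_mul (c := 1) h1 (by fun_prop)
        ((ae_restrict_iff' measurableSet_Ioi).2 (ae_of_all _ hexp))
    refine h2.congr_fun (fun t _ => ?_) measurableSet_Ioi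
    simp only [rvLaplace_add_const]
    ring
  have hmom := fun n => hF.integral_sq_comp
    ((hξ.measurable_movingAverage (lam := lam) ω₀ n).add_const ε)
    ((hξ.ae_movingAverage_pos hlam hω₀ n).mono fun w hw => add_pos_of_pos_of_nonneg hw hε) (hint n)
  refine ⟨fun n => (hmom n).1, ?_⟩
  simp_rw [(hmom _).2]
  obtain ⟨n₀, b, hb, hle⟩ := hξ.exists_integrableOn_bound hlam hF hω₀ hfin
  refine tendsto_integral_filter_of_dominated_convergence b
    (Eventually.of_forall fun n => (hint n).aestronglyMeasurable) ?_ hb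
    ((ae_restrict_iff' measurableSet_Ioi).2 (ae_of_all _ fun t ht => ?_))
  · filter_upwards [eventually_ge_atTop n₀] with n hn
    refine (ae_restrict_iff' measurableSet_Ioi).2 (ae_of_all _ fun t ht => ?_)
    have h0 := mul_nonneg (selfConv_nonneg hF.nonneg_right ht)
      (rvLaplace_nonneg (P := P) (X := movingAverage lam ω₀ ξ n) t)
    rw [rvLaplace_add_const, mul_left_comm, norm_mul]
    refine (mul_le_of_le_one_left (norm_nonneg _) (hexp t ht)).trans ?_
    rw [Real.norm_eq_abs, abs_of_nonneg h0]
    exact hle n hn t ht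
  · simp_rw [rvLaplace_add_const, mul_left_comm (selfConv f t)]
    exact ((hξ.tendsto_rvLaplace_movingAverage hlam ω₀ (le_of_lt ht)).const_mul _).const_mul _

end IsLaplaceNoise

end variance

/-! ### Decay of correlations. -/

/-- The part of the moving average at time `i + m` which comes from the noise after time `i`. -/
noncomputable def recentPart {Ω : Type*} (lam : ℕ → ℝ) (ξ : ℕ → Ω → ℝ) (i m : ℕ) (w : Ω) : ℝ :=
  ∑ k ∈ Finset.Ico i (i + m), lam (i + m - 1 - k) * ξ (k + 1) w

/-- The remaining part of the moving average at time `i + m`. -/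
noncomputable def remotePart {Ω : Type*} (lam : ℕ → ℝ) (ω₀ : ℝ) (ξ : ℕ → Ω → ℝ) (i m : ℕ) (w : Ω) : ℝ :=
  tailWeight lam (i + m) * ω₀ + ∑ k ∈ Finset.range i, lam (i + m - 1 - k) * ξ (k + 1) w

theorem movingAverage_eq_recentPart_add_remotePart {Ω : Type*} (lam : ℕ → ℝ) (ω₀ : ℝ)
    (ξ : ℕ → Ω → ℝ) (i m : ℕ) (w : Ω) :
    movingAverage lam ω₀ ξ (i + m) w = recentPart lam ξ i m w + remotePart lam ω₀ ξ i m w := by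
  rw [movingAverage_eq, recentPart, remotePart,
    ← Finset.sum_range_add_sum_Ico _ (Nat.le_add_right i m)]
  ring

section covariance

variable {Ω : Type*} [mΩ : MeasurableSpace Ω] {P : Measure Ω}
  {ξ : ℕ → Ω → ℝ} {α β c : ℝ} {lam : ℕ → ℝ} {γ : ℝ} {F f : ℝ → ℝ} {ω₀ : ℝ}

theorem IsPolyLaplace.exists_sq_laplaceTransform_sub_le (hF : IsPolyLaplace F f) {ε : ℝ}
    (hε : 0 < ε) :
    ∃ C, 0 ≤ C ∧ ∀ x r : ℝ, 0 ≤ x → 0 ≤ r →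
      |laplaceTransform f (x + r + ε) ^ 2 - laplaceTransform f (x + ε) ^ 2|
        ≤ C * (1 - Real.exp (-r)) := by
  obtain ⟨C, hC, hle⟩ := hF.exists_laplaceTransform_sub_le hε
  refine ⟨2 * laplaceTransform f ε * C,
    mul_nonneg (mul_nonneg zero_le_two hF.laplaceTransform_nonneg) hC, fun x r hx hr => ?_⟩
  have h1 := hle x r hx hr
  have h2 := hF.laplaceTransform_anti (x := x + ε) (y := x + r + ε) (by linarith) (by linarith)
  have h3 := hF.laplaceTransform_anti (x := ε) (y := x + ε) hε (by linarith)
  have h4 : 0 ≤ laplaceTransform f (x + r + ε) := hF.laplaceTransform_nonneg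
  rw [abs_sub_comm, abs_of_nonneg (by nlinarith)]
  calc _ = (laplaceTransform f (x + ε) + laplaceTransform f (x + r + ε)) *
        (laplaceTransform f (x + ε) - laplaceTransform f (x + r + ε)) := by ring
    _ ≤ (2 * laplaceTransform f ε) * (C * (1 - Real.exp (-r))) :=
        mul_le_mul (by linarith) h1 (by linarith) (by linarith)
    _ = _ := by ring

/-- An upper bound, in terms of the elapsed time, for the influence of the remote past. -/
noncomputable def mixingRate (lam : ℕ → ℝ) (α ω₀ : ℝ) (m : ℕ) : ℝ :=
  tailWeight lam m * ω₀ + ∑' k, lam (k + m) ^ α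

theorem IsDecayingWeight.tendsto_mixingRate (hlam : IsDecayingWeight lam γ) :
    Tendsto (mixingRate lam α ω₀) atTop (𝓝 0) := by
  have h1 := hlam.tendsto_tailWeight.mul_const ω₀
  have h2 := tendsto_sum_nat_add fun k => lam k ^ α
  have h3 := h1.add h2
  rwa [zero_mul, add_zero] at h3

namespace IsLaplaceNoise

variable (hξ : IsLaplaceNoise P ξ α β c)
include hξ

theorem measurable_recentPart (i m : ℕ) : Measurable (recentPart lam ξ i m) :=
  Finset.measurable_fun_sum _ fun k _ => (hξ.meas (k + 1) (by omega)).const_mul _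

theorem measurable_remotePart (i m : ℕ) : Measurable (remotePart lam ω₀ ξ i m) :=
  (Finset.measurable_fun_sum _ fun k _ => (hξ.meas (k + 1) (by omega)).const_mul _).const_add _

/-- The two variables use disjoint blocks of the noise: indices up to i, and i + 1 to i + m. -/
theorem indepFun_movingAverage_recentPart (i m : ℕ) :
    IndepFun (movingAverage lam ω₀ ξ i) (recentPart lam ξ i m) P := by
  have h := hξ.indep.indepFun_finset (Finset.range i) (Finset.Ico i (i + m))
    (by rw [Finset.range_eq_Ico]; exact Finset.Ico_disjoint_Ico_consecutive 0 i (i + m))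
    fun k => hξ.meas (k + 1) (by omega)
  have h1 : movingAverage lam ω₀ ξ i = (fun y : Finset.range i → ℝ => tailWeight lam i * ω₀ +
      ∑ k : Finset.range i, lam (i - 1 - k) * y k) ∘ fun w (k : Finset.range i) => ξ (k + 1) w := by
    ext w
    simp only [Function.comp_apply]
    rw [movingAverage_eq,
      ← Finset.sum_coe_sort (Finset.range i) fun k => lam (i - 1 - k) * ξ (k + 1) w]
  have h2 : recentPart lam ξ i m = (fun y : Finset.Ico i (i + m) → ℝ =>
      ∑ k : Finset.Ico i (i + m), lam (i + m - 1 - k) * y k) ∘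
        fun w (k : Finset.Ico i (i + m)) => ξ (k + 1) w := by
    ext w
    simp only [Function.comp_apply]
    rw [recentPart, ← Finset.sum_coe_sort (Finset.Ico i (i + m))
      fun k => lam (i + m - 1 - k) * ξ (k + 1) w]
  rw [h1, h2]
  exact h.comp (by fun_prop) (by fun_prop)

variable [IsProbabilityMeasure P] (hlam : IsDecayingWeight lam γ)
include hlam

/-- Subadditivity splits the remote part into single noise terms, each costing 1 - φ(λ_j) ≤ λ_j^α.
Only weights with j ≥ m occur, so the bound is uniform in i. -/
theorem integral_one_sub_exp_remotePart_le (hω₀ : 0 ≤ ω₀) (i m : ℕ) :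
    ∫ w, (1 - Real.exp (-remotePart lam ω₀ ξ i m w)) ∂P ≤ mixingRate lam α ω₀ m := by
  have hterm : ∀ k, Integrable (fun w => 1 - Real.exp (-(lam (i + m - 1 - k) * ξ (k + 1) w))) P :=
    fun k => by
      refine (integrable_const 1).sub ?_
      have := integrable_exp_neg_mul (hξ.meas (k + 1) (by omega)) (hξ.nonneg (k + 1) (by omega))
        (hlam.nonneg (i + m - 1 - k))
      simpa only [neg_mul] using this
  have hval : ∀ k, ∫ w, (1 - Real.exp (-(lam (i + m - 1 - k) * ξ (k + 1) w))) ∂P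
      ≤ lam (i + m - 1 - k) ^ α := fun k => by
    have h1 := integrable_exp_neg_mul (hξ.meas (k + 1) (by omega)) (hξ.nonneg (k + 1) (by omega))
        (hlam.nonneg (i + m - 1 - k))
    have h2 : ∫ w, Real.exp (-lam (i + m - 1 - k) * ξ (k + 1) w) ∂P
        = rvLaplace P (ξ 1) (lam (i + m - 1 - k)) :=
      mgf_congr_of_identDistrib _ _ (hξ.ident (k + 1) (by omega)) (-lam (i + m - 1 - k))
    have h3 := hξ.lower _ (hlam.nonneg (i + m - 1 - k))
    simp only [← neg_mul]
    rw [integral_sub (integrable_const 1) h1, h2]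
    simp only [integral_const, probReal_univ, one_smul]
    linarith
  have hsum : ∑ k ∈ Finset.range i, lam (i + m - 1 - k) ^ α ≤ ∑' k, lam (k + m) ^ α := by
    have hs : Summable fun k => lam (k + m) ^ α :=
      (summable_nat_add_iff m).2 (hlam.summable_rpow hξ.exponent_pos)
    have h1 : ∑ k ∈ Finset.range i, lam (i + m - 1 - k) ^ α
        = ∑ k ∈ Finset.range i, lam (k + m) ^ α := by
      rw [← Finset.sum_range_reflect]
      refine Finset.sum_congr rfl fun k hk => ?_
      have := Finset.mem_range.1 hk
      rw [show i + m - 1 - (i - 1 - k) = k + m by omega]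
    rw [h1]
    exact hs.sum_le_tsum _ fun k _ => Real.rpow_nonneg (hlam.nonneg _) _
  have hpt : ∀ᵐ w ∂P, 1 - Real.exp (-remotePart lam ω₀ ξ i m w) ≤ tailWeight lam m * ω₀ +
      ∑ k ∈ Finset.range i, (1 - Real.exp (-(lam (i + m - 1 - k) * ξ (k + 1) w))) := by
    filter_upwards [hξ.ae_pos] with w hw
    have hr : ∀ k, 0 ≤ lam (i + m - 1 - k) * ξ (k + 1) w := fun k =>
      mul_nonneg (hlam.nonneg _) (hw k).le
    have ha : 0 ≤ tailWeight lam (i + m) * ω₀ := mul_nonneg (hlam.tailWeight_nonneg _) hω₀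
    have h1 := one_sub_exp_neg_add_le ha (Finset.sum_nonneg fun k (_ : k ∈ Finset.range i) => hr k)
    have h2 := one_sub_exp_neg_sum_le (Finset.range i) hr
    have h3 := Real.one_sub_le_exp_neg (tailWeight lam (i + m) * ω₀)
    have h4 : tailWeight lam (i + m) * ω₀ ≤ tailWeight lam m * ω₀ :=
      mul_le_mul_of_nonneg_right (hlam.tailWeight_anti (Nat.le_add_left m i)) hω₀
    rw [remotePart]
    linarith
  have hi : Integrable (fun w => ∑ k ∈ Finset.range i,
      (1 - Real.exp (-(lam (i + m - 1 - k) * ξ (k + 1) w)))) P :=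
    integrable_finsetSum _ fun k _ => hterm k
  have hl : Integrable (fun w => 1 - Real.exp (-remotePart lam ω₀ ξ i m w)) P := by
    have hm := hξ.measurable_remotePart (lam := lam) (ω₀ := ω₀) i m
    refine Integrable.of_bound (by fun_prop) 1 ?_
    filter_upwards [hξ.ae_pos] with w hw
    have h0 : 0 ≤ remotePart lam ω₀ ξ i m w :=
      add_nonneg (mul_nonneg (hlam.tailWeight_nonneg _) hω₀) (Finset.sum_nonneg fun k _ =>
        mul_nonneg (hlam.nonneg _) (hw k).le)
    have h1 : Real.exp (-remotePart lam ω₀ ξ i m w) ≤ 1 := Real.exp_le_one_iff.2 (by linarith)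
    rw [Real.norm_eq_abs, abs_of_nonneg (by linarith)]
    linarith [Real.exp_pos (-remotePart lam ω₀ ξ i m w)]
  refine (integral_mono_ae hl ((integrable_const _).add hi) hpt).trans ?_
  simp only [Pi.add_apply]
  rw [integral_add (integrable_const _) hi, integral_finsetSum _ fun k _ => hterm k,
    integral_const, probReal_univ, one_smul, mixingRate]
  exact add_le_add le_rfl ((Finset.sum_le_sum fun k _ => hval k).trans hsum)

/-- Decay of correlations for the squares of `F (ω_n + ε)`, with bounded deterministic weights. -/
theorem exists_covariance_le (hF : IsPolyLaplace F f) (hω₀ : 0 ≤ ω₀) {ε : ℝ} (hε : 0 < ε)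
    {v : ℕ → ℝ} {v₀ : ℝ} (hv : ∀ i, 0 ≤ v i) (hv₀ : ∀ i, v i ≤ v₀) :
    ∃ C, ∀ i m,
      |cov[fun w => laplaceTransform f (|movingAverage lam ω₀ ξ i w| + ε) ^ 2 * v i,
        fun w => laplaceTransform f (|movingAverage lam ω₀ ξ (i + m) w| + ε) ^ 2 * v (i + m); P]|
      ≤ C * mixingRate lam α ω₀ m := by
  obtain ⟨C, hC, hle⟩ := hF.exists_sq_laplaceTransform_sub_le hε
  have hv₀0 : 0 ≤ v₀ := (hv 0).trans (hv₀ 0)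
  set K := laplaceTransform f ε with hK
  have hK0 : 0 ≤ K := hF.laplaceTransform_nonneg
  -- The absolute value keeps the argument at least ε for every outcome, so the bounds hold
  -- everywhere and not only almost surely.
  have hbd : ∀ x j, |laplaceTransform f (|x| + ε) ^ 2 * v j| ≤ K ^ 2 * v₀ := fun x j => by
    have h1 := hF.laplaceTransform_anti (x := ε) (y := |x| + ε) hε (by linarith [abs_nonneg x])
    have h2 : 0 ≤ laplaceTransform f (|x| + ε) := hF.laplaceTransform_nonneg
    rw [abs_of_nonneg (mul_nonneg (sq_nonneg _) (hv j))]
    exact mul_le_mul (pow_le_pow_left₀ h2 h1 2) (hv₀ j) (hv j) (sq_nonneg _)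
  have hLm := hF.measurable_laplaceTransform
  refine ⟨2 * (K ^ 2 * v₀) * (v₀ * C), fun i m => ?_⟩
  have hm1 := hξ.measurable_movingAverage (lam := lam) ω₀ i
  have hm2 := hξ.measurable_movingAverage (lam := lam) ω₀ (i + m)
  have hm3 := hξ.measurable_recentPart (lam := lam) i m
  have hm4 := hξ.measurable_remotePart (lam := lam) (ω₀ := ω₀) i m
  have hmeas : ∀ j, Measurable fun x : ℝ => laplaceTransform f (|x| + ε) ^ 2 * v j := fun j =>
    ((hLm.comp (by fun_prop : Measurable fun x : ℝ => |x| + ε)).pow_const 2).mul_const _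
  have hcov := abs_covariance_le_of_indepFun (P := P)
    (U := fun w => laplaceTransform f (|movingAverage lam ω₀ ξ i w| + ε) ^ 2 * v i)
    (V := fun w => laplaceTransform f (|movingAverage lam ω₀ ξ (i + m) w| + ε) ^ 2 * v (i + m))
    (V' := fun w => laplaceTransform f (|recentPart lam ξ i m w| + ε) ^ 2 * v (i + m))
    ((hmeas i).comp hm1) ((hmeas _).comp hm2) ((hmeas _).comp hm3)
    (fun w => hbd _ _) (fun w => hbd _ _) (fun w => hbd _ _)
    ((hξ.indepFun_movingAverage_recentPart i m).comp (hmeas i) (hmeas (i + m)))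
  refine hcov.trans ?_
  rw [mul_assoc (2 * (K ^ 2 * v₀))]
  refine mul_le_mul_of_nonneg_left ?_
    (mul_nonneg zero_le_two (mul_nonneg (sq_nonneg K) hv₀0))
  have hpt : ∀ᵐ w ∂P,
      |laplaceTransform f (|movingAverage lam ω₀ ξ (i + m) w| + ε) ^ 2 * v (i + m)
        - laplaceTransform f (|recentPart lam ξ i m w| + ε) ^ 2 * v (i + m)|
      ≤ (v₀ * C) * (1 - Real.exp (-remotePart lam ω₀ ξ i m w)) := by
    filter_upwards [hξ.ae_pos] with w hw
    have h0 : 0 ≤ remotePart lam ω₀ ξ i m w :=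
      add_nonneg (mul_nonneg (hlam.tailWeight_nonneg _) hω₀) (Finset.sum_nonneg fun k _ =>
        mul_nonneg (hlam.nonneg _) (hw k).le)
    have h1 : 0 ≤ recentPart lam ξ i m w :=
      Finset.sum_nonneg fun k _ => mul_nonneg (hlam.nonneg _) (hw k).le
    rw [movingAverage_eq_recentPart_add_remotePart, abs_of_nonneg (add_nonneg h1 h0),
      abs_of_nonneg h1, ← sub_mul, abs_mul, abs_of_nonneg (hv _), mul_comm, mul_assoc]
    exact mul_le_mul (hv₀ _) (hle _ _ h1 h0) (abs_nonneg _) hv₀0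
  have hl : Integrable (fun w => (v₀ * C) * (1 - Real.exp (-remotePart lam ω₀ ξ i m w))) P := by
    refine Integrable.of_bound (by fun_prop) (v₀ * C) ?_
    filter_upwards [hξ.ae_pos] with w hw
    have h0 : 0 ≤ remotePart lam ω₀ ξ i m w :=
      add_nonneg (mul_nonneg (hlam.tailWeight_nonneg _) hω₀) (Finset.sum_nonneg fun k _ =>
        mul_nonneg (hlam.nonneg _) (hw k).le)
    have h1 : Real.exp (-remotePart lam ω₀ ξ i m w) ≤ 1 := Real.exp_le_one_iff.2 (by linarith)
    have h2 : 0 ≤ v₀ * C := mul_nonneg hv₀0 hC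
    rw [Real.norm_eq_abs, abs_of_nonneg (mul_nonneg h2 (by linarith))]
    exact mul_le_of_le_one_right h2 (by linarith [Real.exp_pos (-remotePart lam ω₀ ξ i m w)])
  refine (integral_mono_of_nonneg (ae_of_all _ fun w => abs_nonneg _) hl hpt).trans ?_
  rw [integral_const_mul, mul_assoc, mul_assoc]
  exact mul_le_mul_of_nonneg_left (mul_le_mul_of_nonneg_left
    (hξ.integral_one_sub_exp_remotePart_le hlam hω₀ i m) hC) hv₀0

end IsLaplaceNoise

end covariance

/-! ### Removing the regularisation. -/

theorem norm_exp_mul_I_sub_exp_mul_I_le (a b : ℝ) :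
    ‖Complex.exp (a * Complex.I) - Complex.exp (b * Complex.I)‖ ≤ |a - b| := by
  have h : Complex.exp (a * Complex.I) - Complex.exp (b * Complex.I)
      = Complex.exp (b * Complex.I) * (Complex.exp (Complex.I * (a - b : ℝ)) - 1) := by
    rw [mul_sub, ← Complex.exp_add, mul_one]
    congr 2
    push_cast
    ring
  rw [h, norm_mul, Complex.norm_exp_ofReal_mul_I, one_mul]
  exact Real.norm_exp_I_mul_ofReal_sub_one_le

/-- A three-δ argument for an iterated limit: for fixed i the error need not vanish as n → ∞, only
its limit must vanish along l. -/
theorem tendsto_of_forall_approx {E ι : Type*} [SeminormedAddCommGroup E] {l : Filter ι} [l.NeBot]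
    {a : ℕ → E} {L : E} {b : ι → ℕ → E} {r : ι → ℕ → ℝ} {M : ι → E} {s : ι → ℝ}
    (hle : ∀ᶠ i in l, ∀ n, ‖a n - b i n‖ ≤ r i n)
    (hr : ∀ᶠ i in l, Tendsto (r i) atTop (𝓝 (s i)))
    (hb : ∀ᶠ i in l, Tendsto (b i) atTop (𝓝 (M i)))
    (hs : Tendsto s l (𝓝 0)) (hM : Tendsto M l (𝓝 L)) : Tendsto a atTop (𝓝 L) := by
  rw [Metric.tendsto_atTop']
  intro δ hδ
  have hδ3 : 0 < δ / 3 := by positivity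
  obtain ⟨i, h1, h2, h3, h4, h5⟩ := (hle.and (hr.and (hb.and
    ((hs.eventually_lt_const hδ3).and (Metric.tendsto_nhds.1 hM _ hδ3))))).exists
  have h6 := (h2.eventually_lt_const h4).and (Metric.tendsto_nhds.1 h3 _ hδ3)
  obtain ⟨N, hN⟩ := eventually_atTop.1 h6
  refine ⟨N, fun n hn => ?_⟩
  obtain ⟨h7, h8⟩ := hN n hn.le
  have h9 := h1 n
  rw [← dist_eq_norm] at h9
  linarith [dist_triangle4 (a n) (b i n) (M i) L]

section main

variable {Ω : Type*} [mΩ : MeasurableSpace Ω] {P : Measure Ω} [IsProbabilityMeasure P]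
  {ξ : ℕ → Ω → ℝ} {α β c : ℝ} {lam : ℕ → ℝ} {γ : ℝ} {F f : ℝ → ℝ} {ω₀ : ℝ}

/-- Convergence of the characteristic functions, for innovations `e i` independent of the past. -/
theorem IsLaplaceNoise.tendsto_integral_exp_sum (hξ : IsLaplaceNoise P ξ α β c)
    (hlam : IsDecayingWeight lam γ) (hF : IsPolyLaplace F f) (hω₀ : 0 < ω₀)
    (hfin : (Function.support lam).Finite →
      IntegrableOn (varianceIntegrand f (rvLaplace P (ξ 1)) lam) (Set.Ioi 0))
    {𝓕 : Filtration ℕ mΩ} {e : ℕ → Ω → ℝ}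
    (hadapt : ∀ n, Measurable[𝓕 n] (movingAverage lam ω₀ ξ n))
    (he : ∀ i, Measurable[𝓕 (i + 1)] (e i))
    (hind : ∀ i, Indep (𝓕 i) (MeasurableSpace.comap (e i) inferInstance) P)
    {q M v₀ : ℝ} (hq2 : 2 < q) (hq3 : q ≤ 3) (h2 : ∀ i, MemLp (e i) 2 P)
    (hmean : ∀ i, ∫ w, e i w ∂P = 0)
    (hint : ∀ i, Integrable (fun w => |e i w| ^ q) P) (hM : ∀ i, ∫ w, |e i w| ^ q ∂P ≤ M)
    (hv₀ : ∀ i, ∫ w, e i w ^ 2 ∂P ≤ v₀)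
    (hvlim : Tendsto (fun i => ∫ w, e i w ^ 2 ∂P) atTop (𝓝 1)) (u : ℝ) :
    Tendsto (fun N : ℕ => ∫ w, Complex.exp ((u * ((√(N : ℝ))⁻¹ *
      ∑ i ∈ Finset.range N, laplaceTransform f (movingAverage lam ω₀ ξ i w) * e i w) : ℝ)
        * Complex.I) ∂P) atTop
      (𝓝 ((Real.exp (-(u ^ 2 * limitVariance f (rvLaplace P (ξ 1)) lam / 2)) : ℝ) : ℂ)) := by
  have hV := hξ.integrableOn_varianceIntegrand hlam hF hω₀ hfin
  have hVlim := hξ.tendsto_integral_exp_mul_varianceIntegrand hlam hF hV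
  set V := limitVariance f (rvLaplace P (ξ 1)) lam with hVdef
  set Vs : ℝ → ℝ := fun ε => ∫ t in Set.Ioi 0,
        Real.exp (-ε * t) * varianceIntegrand f (rvLaplace P (ξ 1)) lam t with hVs
  have hV0 : Vs 0 = V := by
    simp only [hVs, neg_zero, zero_mul, Real.exp_zero, one_mul]
    rfl
  set v : ℕ → ℝ := fun i => ∫ w, e i w ^ 2 ∂P with hvdef
  have hv : ∀ i, 0 ≤ v i := fun i => integral_nonneg fun w => sq_nonneg _
  have hv₀0 : 0 ≤ v₀ := (hv 0).trans (hv₀ 0)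
  have he' : ∀ i, Measurable (e i) := fun i => (he i).mono (𝓕.le _) le_rfl
  have hLm := hF.measurable_laplaceTransform
  let X : ℕ → Ω → ℝ := fun i w => laplaceTransform f (movingAverage lam ω₀ ξ i w)
  let Y : ℝ → ℕ → Ω → ℝ := fun ε i w => laplaceTransform f (|movingAverage lam ω₀ ξ i w| + ε)
  have hXa : ∀ i, Measurable[𝓕 i] (X i) := fun i => hLm.comp (hadapt i)
  have hYa : ∀ ε i, Measurable[𝓕 i] (Y ε i) := fun ε i =>
    (hLm.comp (by fun_prop : Measurable fun x : ℝ => |x| + ε)).comp (hadapt i)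
  have hXm : ∀ i, Measurable (X i) := fun i => (hXa i).mono (𝓕.le i) le_rfl
  have hYm : ∀ ε i, Measurable (Y ε i) := fun ε i => (hYa ε i).mono (𝓕.le i) le_rfl
  have hmom0 := hξ.integral_sq_laplaceTransform_movingAverage hlam hF hω₀ hfin le_rfl
  simp only [add_zero] at hmom0
  obtain ⟨hX2, hXlim⟩ := hmom0
  have hXlim : Tendsto (fun i => ∫ w, X i w ^ 2 ∂P) atTop (𝓝 V) := by
    rw [← hV0]
    exact hXlim
  have hYae : ∀ ε i, (fun w => laplaceTransform f (movingAverage lam ω₀ ξ i w + ε)) =ᵐ[P] Y ε i :=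
    fun ε i => by
      filter_upwards [hξ.ae_movingAverage_pos hlam hω₀ i] with w hw
      simp only [Y, abs_of_pos hw]
  have hY2 : ∀ ε, 0 < ε → ∀ i, MemLp (Y ε i) 2 P := fun ε hε i =>
    ((hξ.integral_sq_laplaceTransform_movingAverage hlam hF hω₀ hfin hε.le).1 i).ae_eq (hYae ε i)
  have hYlim : ∀ ε, 0 < ε → Tendsto (fun i => ∫ w, Y ε i w ^ 2 ∂P) atTop (𝓝 (Vs ε)) :=
    fun ε hε => by
      refine (hξ.integral_sq_laplaceTransform_movingAverage hlam hF hω₀ hfin hε.le).2.congr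
        fun i => integral_congr_ae ?_
      filter_upwards [hYae ε i] with w hw
      rw [hw]
  have hYK : ∀ ε, 0 < ε → ∀ i w, |Y ε i w| ≤ laplaceTransform f ε := fun ε hε i w => by
    rw [abs_of_nonneg hF.laplaceTransform_nonneg]
    exact hF.laplaceTransform_anti hε (by linarith [abs_nonneg (movingAverage lam ω₀ ξ i w)])
  have hlln : ∀ ε, 0 < ε → Tendsto (fun N : ℕ => ∫ w, |(N : ℝ)⁻¹ *
      (∑ i ∈ Finset.range N, Y ε i w ^ 2 * v i) - Vs ε| ∂P) atTop (𝓝 0) := fun ε hε => by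
    obtain ⟨C, hC⟩ := hξ.exists_covariance_le hlam hF hω₀.le hε hv hv₀
    refine tendsto_integral_abs_average_sub (Y := fun i w => Y ε i w ^ 2 * v i)
      (fun i => ?_) hC ?_ ?_
    · refine MemLp.of_bound (((hYm ε i).pow_const 2).mul_const _).aestronglyMeasurable
        (laplaceTransform f ε ^ 2 * v i) (ae_of_all _ fun w => ?_)
      rw [Real.norm_eq_abs, abs_mul, abs_of_nonneg (hv i), abs_pow]
      exact mul_le_mul_of_nonneg_right (pow_le_pow_left₀ (abs_nonneg _) (hYK ε hε i w) 2) (hv i)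
    · have := (hlam.tendsto_mixingRate (α := α) (ω₀ := ω₀)).const_mul C
      rwa [mul_zero] at this
    · have := (hYlim ε hε).mul hvlim
      rw [mul_one] at this
      refine this.congr fun i => ?_
      rw [integral_mul_const]
  let S : (ℕ → Ω → ℝ) → ℕ → Ω → ℝ := fun Z N w => ∑ i ∈ Finset.range N, Z i w * e i w
  have hSm : ∀ Z : ℕ → Ω → ℝ, (∀ i, Measurable (Z i)) → ∀ N, Measurable (S Z N) := fun Z hZ N =>
    Finset.measurable_fun_sum _ fun i _ => (hZ i).mul (he' i)
  let g : ℝ → ℕ → ℝ := fun ε i => (∫ w, X i w ^ 2 ∂P - ∫ w, Y ε i w ^ 2 ∂P) * v i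
  have hglim : ∀ ε, 0 < ε → Tendsto (g ε) atTop (𝓝 (V - Vs ε)) := fun ε hε => by
    have := (hXlim.sub (hYlim ε hε)).mul hvlim
    rwa [mul_one] at this
  -- As 0 ≤ Y ≤ X almost surely, (X - Y)² ≤ X² - Y²; convergence of second moments alone thus
  -- controls the L² error.
  have hD : ∀ ε, 0 < ε → ∀ i, ∫ w, (X i w - Y ε i w) ^ 2 ∂P
      ≤ ∫ w, X i w ^ 2 ∂P - ∫ w, Y ε i w ^ 2 ∂P := fun ε hε i => by
    rw [← integral_sub (hX2 i).integrable_sq (hY2 ε hε i).integrable_sq]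
    refine integral_mono_ae ((hX2 i).sub (hY2 ε hε i)).integrable_sq
      ((hX2 i).integrable_sq.sub (hY2 ε hε i).integrable_sq) ?_
    filter_upwards [hξ.ae_movingAverage_pos hlam hω₀ i] with w hw
    have h1 : 0 ≤ Y ε i w := hF.laplaceTransform_nonneg
    have h3 : Y ε i w ≤ X i w := by
      refine hF.laplaceTransform_anti hw ?_
      rw [abs_of_pos hw]
      linarith
    change (X i w - Y ε i w) ^ 2 ≤ X i w ^ 2 - Y ε i w ^ 2
    nlinarith
  have happrox : ∀ ε, 0 < ε → ∀ N : ℕ,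
      ‖∫ w, Complex.exp ((u * ((√(N : ℝ))⁻¹ * S X N w) : ℝ) * Complex.I) ∂P
        - ∫ w, Complex.exp ((u * ((√(N : ℝ))⁻¹ * S (Y ε) N w) : ℝ) * Complex.I) ∂P‖
      ≤ |u| * √((N : ℝ)⁻¹ * ∑ i ∈ Finset.range N, g ε i) := fun ε hε N => by
    have hI : ∀ Z : ℕ → Ω → ℝ, (∀ i, Measurable (Z i)) → Integrable (fun w =>
        Complex.exp ((u * ((√(N : ℝ))⁻¹ * S Z N w) : ℝ) * Complex.I)) P := fun Z hZ => by
      have := hSm Z hZ N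
      refine Integrable.of_bound (by fun_prop) 1 (ae_of_all _ fun w => ?_)
      rw [Complex.norm_exp_ofReal_mul_I]
    obtain ⟨hDS, hDval⟩ := memLp_sum_mul_innovation (X := fun i w => X i w - Y ε i w)
      (fun i => (hXa i).sub (hYa ε i)) he hind h2 hmean
      (fun i => (hX2 i).sub (hY2 ε hε i)) N
    have hDS' := hDS.const_mul (√(N : ℝ))⁻¹
    rw [← integral_sub (hI X hXm) (hI (Y ε) (hYm ε))]
    calc _ ≤ ∫ w, |u| * |(√(N : ℝ))⁻¹ *
          ∑ i ∈ Finset.range N, (X i w - Y ε i w) * e i w| ∂P := by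
          refine norm_integral_le_of_norm_le ((hDS'.integrable (by norm_num)).abs.const_mul _)
            (ae_of_all _ fun w => (norm_exp_mul_I_sub_exp_mul_I_le _ _).trans (le_of_eq ?_))
          rw [← abs_mul]
          congr 1
          simp only [S, sub_mul, Finset.sum_sub_distrib]
          ring
      _ ≤ _ := by
          rw [integral_const_mul]
          refine mul_le_mul_of_nonneg_left ((integral_abs_le_sqrt_integral_sq hDS').trans
            (Real.sqrt_le_sqrt ?_)) (abs_nonneg u)
          simp_rw [mul_pow]
          rw [integral_const_mul, hDval, inv_pow, Real.sq_sqrt (Nat.cast_nonneg N)]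
          refine mul_le_mul_of_nonneg_left (Finset.sum_le_sum fun i _ =>
            mul_le_mul_of_nonneg_right (hD ε hε i) (hv i)) (by positivity)
  -- First N → ∞ at fixed ε, leaving the error |u| √(V - V_ε), then ε ↓ 0.
  refine tendsto_of_forall_approx (l := 𝓝[>] (0 : ℝ))
    (r := fun ε N => |u| * √((N : ℝ)⁻¹ * ∑ i ∈ Finset.range N, g ε i))
    (s := fun ε => |u| * √(V - Vs ε))
    (M := fun ε => ((Real.exp (-(u ^ 2 * Vs ε / 2)) : ℝ) : ℂ))
    (eventually_mem_nhdsWithin.mono fun ε hε => happrox ε hε)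
    (eventually_mem_nhdsWithin.mono fun ε hε => ?_)
    (eventually_mem_nhdsWithin.mono fun ε hε => ?_) ?_ ?_
  · exact ((hglim ε hε).cesaro.sqrt).const_mul _
  · exact tendsto_integral_exp_sum_mul_innovation (hYa ε) he hind hq2 hq3 h2 hmean hint hM hv₀
      (hYK ε hε) (hlln ε hε) u
  · have := ((hVlim.const_sub V).sqrt).const_mul |u|
    simpa using this
  · exact (Complex.continuous_ofReal.tendsto _).comp
      ((Real.continuous_exp.tendsto _).comp (((hVlim.const_mul (u ^ 2)).div_const 2).neg))

end main

/-! ### The filtration of the past, and the main theorem. -/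

section history

variable {Ω : Type*} [mΩ : MeasurableSpace Ω]

/-- The filtration generated by `(ξ k, η k)`, `1 ≤ k ≤ n`. -/
def historyFiltration (ξ η : ℕ → Ω → ℝ) (hξ : ∀ n, 1 ≤ n → Measurable (ξ n))
    (hη : ∀ n, 1 ≤ n → Measurable (η n)) : Filtration ℕ mΩ where
  seq n := MeasurableSpace.comap
    (fun w => fun k : Finset.Icc 1 n => ((ξ k w, η k w) : ℝ × ℝ)) inferInstance
  mono' i j hij := by
    let φ : (Finset.Icc 1 j → ℝ × ℝ) → (Finset.Icc 1 i → ℝ × ℝ) := fun y k =>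
      y ⟨k, Finset.mem_Icc.2 ⟨(Finset.mem_Icc.1 k.2).1, (Finset.mem_Icc.1 k.2).2.trans hij⟩⟩
    have hφ : Measurable φ := measurable_pi_lambda _ fun k => measurable_pi_apply _
    change MeasurableSpace.comap (φ ∘ fun w => fun k : Finset.Icc 1 j =>
      ((ξ k w, η k w) : ℝ × ℝ)) inferInstance ≤ _
    rw [← MeasurableSpace.comap_comp]
    exact MeasurableSpace.comap_mono hφ.comap_le
  le' n := by
    refine Measurable.comap_le (measurable_pi_lambda _ fun k => ?_)
    have hk := Finset.mem_Icc.1 k.2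
    exact (hξ k hk.1).prodMk (hη k hk.1)

variable {ξ η : ℕ → Ω → ℝ} {hξ : ∀ n, 1 ≤ n → Measurable (ξ n)}
  {hη : ∀ n, 1 ≤ n → Measurable (η n)}

theorem measurable_historyFiltration {n k : ℕ} (hk : 1 ≤ k) (hkn : k ≤ n) :
    Measurable[historyFiltration ξ η hξ hη n] fun w => (ξ k w, η k w) :=
  (measurable_pi_apply (⟨k, Finset.mem_Icc.2 ⟨hk, hkn⟩⟩ : Finset.Icc 1 n)).comp
    (comap_measurable fun w => fun k : Finset.Icc 1 n => ((ξ k w, η k w) : ℝ × ℝ))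

theorem measurable_movingAverage_historyFiltration (lam : ℕ → ℝ) (ω₀ : ℝ) (n : ℕ) :
    Measurable[historyFiltration ξ η hξ hη n] (movingAverage lam ω₀ ξ n) := by
  refine Measurable.const_add (Finset.measurable_fun_sum _ fun k hk => ?_) _
  have hk' := Finset.mem_Icc.1 hk
  exact (measurable_fst.comp (measurable_historyFiltration hk'.1 hk'.2)).const_mul _

end history

/-- A bound on a moment of order `p` controls all moments of smaller order. -/
theorem integrable_rpow_abs_of_lintegral_le {Ω : Type*} [MeasurableSpace Ω] {P : Measure Ω}
    [IsProbabilityMeasure P] {e : Ω → ℝ} (he : Measurable e) {p q B : ℝ} (hq : 0 ≤ q) (hqp : q ≤ p)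
    (hB0 : 0 ≤ B) (hB : ∫⁻ w, ENNReal.ofReal (|e w| ^ p) ∂P ≤ ENNReal.ofReal B) :
    Integrable (fun w => |e w| ^ q) P ∧ ∫ w, |e w| ^ q ∂P ≤ 1 + B := by
  have hm : Measurable fun w => |e w| ^ p := by fun_prop
  have h0 : 0 ≤ᵐ[P] fun w => |e w| ^ p := ae_of_all _ fun w => by positivity
  have hip : Integrable (fun w => |e w| ^ p) P := by
    refine ⟨hm.aestronglyMeasurable, ?_⟩
    rw [hasFiniteIntegral_iff_ofReal h0]
    exact hB.trans_lt ENNReal.ofReal_lt_top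
  have hval : ∫ w, |e w| ^ p ∂P ≤ B := by
    rw [integral_eq_lintegral_of_nonneg_ae h0 hm.aestronglyMeasurable]
    exact ENNReal.toReal_le_of_le_ofReal hB0 hB
  have hpt : ∀ w, |e w| ^ q ≤ 1 + |e w| ^ p := fun w => by
    have hp0 : 0 ≤ |e w| ^ p := by positivity
    rcases le_total |e w| 1 with h | h
    · linarith [Real.rpow_le_one (abs_nonneg (e w)) h hq]
    · linarith [Real.rpow_le_rpow_of_exponent_le h hqp]
  have hiq : Integrable (fun w => |e w| ^ q) P := by
    refine Integrable.mono' ((integrable_const 1).add hip)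
      (by fun_prop : Measurable fun w => |e w| ^ q).aestronglyMeasurable (ae_of_all _ fun w => ?_)
    rw [Real.norm_eq_abs, abs_of_nonneg (by positivity)]
    exact hpt w
  refine ⟨hiq, (integral_mono hiq ((integrable_const 1).add hip) hpt).trans ?_⟩
  simp only [Pi.add_apply]
  rw [integral_add (integrable_const 1) hip]
  simpa using hval

theorem mainTheorem2 {Ω : Type*} [MeasurableSpace Ω] (P : Measure Ω) [IsProbabilityMeasure P]
    -- the weights
    (lam : ℕ → ℝ) (hlam_nonneg : ∀ n, 0 ≤ lam n) (hlam_sum : HasSum lam 1)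
    (γ : ℝ) (hγ : γ ∈ Set.Ioo (0 : ℝ) 1)
    (hlam_decay : BddAbove (Set.range fun n : ℕ => (γ ^ n)⁻¹ * lam n))
    -- the i.i.d. nonnegative sequence `ξ₁, ξ₂, …` (the value at index `0` is not used)
    (ξ : ℕ → Ω → ℝ) (hξ_meas : ∀ n, 1 ≤ n → Measurable (ξ n))
    (hξ_nonneg : ∀ n, 1 ≤ n → ∀ᵐ w ∂P, 0 ≤ ξ n w)
    (hξ_indep : iIndepFun (fun n : ℕ => ξ (n + 1)) P)
    (hξ_ident : ∀ n, 1 ≤ n → IdentDistrib (ξ n) (ξ 1) P P)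
    (α β c : ℝ) (hα : 0 < α) (hα' : α ≤ 1) (hβ : 0 < β) (hc : 0 < c)
    (hφ_lower : ∀ t : ℝ, 0 ≤ t → 1 - t ^ α ≤ rvLaplace P (ξ 1) t)
    (hφ_upper : ∀ t : ℝ, 0 ≤ t → rvLaplace P (ξ 1) t ≤ c * (1 + t) ^ (-β))
    -- the function `F` and its inverse Laplace transform `f`
    (F f : ℝ → ℝ) (hF : IsPolyLaplace F f)
    -- only when finitely many weights are nonzero: the limiting variance is finite
    (hfin : (Function.support lam).Finite →
      IntegrableOn (varianceIntegrand f (rvLaplace P (ξ 1)) lam) (Set.Ioi 0))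
    (ω₀ : ℝ) (hω₀ : 0 < ω₀)
    -- the innovations `η₁, η₂, …` (the value at index `0` is not used)
    (η : ℕ → Ω → ℝ) (hη_meas : ∀ n, 1 ≤ n → Measurable (η n))
    (hη_indep : ∀ n : ℕ, IndepFun (η (n + 1))
      (fun w => fun k : Finset.Icc 1 n => ((ξ k w, η k w) : ℝ × ℝ)) P)
    (hη_mean : ∀ n, 1 ≤ n → ∫ w, η n w ∂P = 0)
    (hη_var : Tendsto (fun n : ℕ => ∫ w, (η n w) ^ 2 ∂P) atTop (𝓝 1))
    (p : ℝ) (hp : 2 < p)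
    (hη_moment : (⨆ n : ℕ, ∫⁻ w, ENNReal.ofReal (|η (n + 1) w| ^ p) ∂P) < (⊤ : ENNReal)) :
    IntegrableOn (varianceIntegrand f (rvLaplace P (ξ 1)) lam) (Set.Ioi 0) ∧
    TendstoInDistribution
      (fun (N : ℕ) (w : Ω) =>
        (√(N : ℝ))⁻¹ * ∑ k ∈ Finset.Icc 1 N, F (movingAverage lam ω₀ ξ (k - 1) w) * η k w)
      atTop (id : ℝ → ℝ) (fun _ => P)
      (gaussianReal 0 (limitVariance f (rvLaplace P (ξ 1)) lam).toNNReal) := by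
  have hξ : IsLaplaceNoise P ξ α β c :=
    ⟨hξ_meas, hξ_nonneg, hξ_indep, hξ_ident, hα, hβ, hc, hφ_lower, hφ_upper⟩
  have hlam : IsDecayingWeight lam γ := ⟨hlam_nonneg, hlam_sum, hγ, hlam_decay⟩
  have hV := hξ.integrableOn_varianceIntegrand hlam hF hω₀ hfin
  refine ⟨hV, ?_⟩
  have hV0 : 0 ≤ limitVariance f (rvLaplace P (ξ 1)) lam :=
    setIntegral_nonneg measurableSet_Ioi fun t ht =>
      varianceIntegrand_nonneg hF ht (hξ.multipliable_rvLaplace hlam (le_of_lt ht))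
  -- The shift pairs F(ω_i) with η_{i+1}, which is independent of the history up to time i.
  let e : ℕ → Ω → ℝ := fun i => η (i + 1)
  have he : ∀ i, Measurable (e i) := fun i => hη_meas (i + 1) (by omega)
  set B := (⨆ n : ℕ, ∫⁻ w, ENNReal.ofReal (|η (n + 1) w| ^ p) ∂P).toReal with hB
  have hBle : ∀ i, ∫⁻ w, ENNReal.ofReal (|e i w| ^ p) ∂P ≤ ENNReal.ofReal B := fun i => by
    rw [hB, ENNReal.ofReal_toReal hη_moment.ne]
    exact le_iSup (fun n : ℕ => ∫⁻ w, ENNReal.ofReal (|η (n + 1) w| ^ p) ∂P) i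
  have hmom : ∀ q : ℝ, 0 ≤ q → q ≤ p → ∀ i,
      Integrable (fun w => |e i w| ^ q) P ∧ ∫ w, |e i w| ^ q ∂P ≤ 1 + B := fun q hq hqp i =>
    integrable_rpow_abs_of_lintegral_le (he i) hq hqp ENNReal.toReal_nonneg (hBle i)
  have hsq : ∀ i w, |e i w| ^ (2 : ℝ) = e i w ^ 2 := fun i w => by
    rw [Real.rpow_two, sq_abs]
  have h2 := hmom 2 zero_le_two hp.le
  simp_rw [hsq] at h2
  -- The Taylor estimate requires 2 < q ≤ 3, so p is capped at 3.
  have hq2 : 2 < min p 3 := lt_min hp (by norm_num)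
  have hq := hmom (min p 3) (by linarith) (min_le_left _ _)
  -- F is the Laplace transform of f only on (0, ∞), hence the almost sure positivity of every ω_n
  -- is used.
  have hFae : ∀ N : ℕ, (fun w => (√(N : ℝ))⁻¹ *
      ∑ i ∈ Finset.range N, laplaceTransform f (movingAverage lam ω₀ ξ i w) * e i w) =ᵐ[P]
      fun w => (√(N : ℝ))⁻¹ *
        ∑ k ∈ Finset.Icc 1 N, F (movingAverage lam ω₀ ξ (k - 1) w) * η k w := fun N => by
    have hpos : ∀ᵐ w ∂P, ∀ n, 0 < movingAverage lam ω₀ ξ n w :=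
      ae_all_iff.2 fun n => hξ.ae_movingAverage_pos hlam hω₀ n
    filter_upwards [hpos] with w hw
    have hI : Finset.Icc 1 N = Finset.Ico 1 (N + 1) := by
      ext k
      simp
    rw [hI, Finset.sum_Ico_eq_sum_range, Nat.add_sub_cancel]
    congr 1
    refine Finset.sum_congr rfl fun i _ => ?_
    rw [Nat.add_sub_cancel_left, hF.eq_laplace _ (hw i), Nat.add_comm 1 i]
  refine TendstoInDistribution.congr hFae (EventuallyEq.refl _ _) ?_
  have hSm : ∀ N : ℕ, Measurable fun w => (√(N : ℝ))⁻¹ *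
      ∑ i ∈ Finset.range N, laplaceTransform f (movingAverage lam ω₀ ξ i w) * e i w := fun N =>
    (Finset.measurable_fun_sum _ fun i _ => (hF.measurable_laplaceTransform.comp
      (hξ.measurable_movingAverage ω₀ i)).mul (he i)).const_mul _
  refine ⟨fun N => (hSm N).aemeasurable, aemeasurable_id, ?_⟩
  refine ProbabilityMeasure.tendsto_iff_tendsto_charFun.2 fun u => ?_
  have key := hξ.tendsto_integral_exp_sum hlam hF hω₀ hfin
    (𝓕 := historyFiltration ξ η hξ_meas hη_meas) (e := e)
    (measurable_movingAverage_historyFiltration lam ω₀)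
    (fun i => measurable_snd.comp (measurable_historyFiltration (by omega) le_rfl))
    (fun i => ((IndepFun_iff_Indep _ _ _).1 (hη_indep i)).symm) hq2 (min_le_right _ _)
    (fun i => (memLp_two_iff_integrable_sq (he i).aestronglyMeasurable).2 (h2 i).1)
    (fun i => hη_mean (i + 1) (by omega)) (fun i => (hq i).1) (fun i => (hq i).2)
    (fun i => (h2 i).2) ((tendsto_add_atTop_iff_nat 1).2 hη_var) u
  have hgauss : charFun ((gaussianReal 0
      (limitVariance f (rvLaplace P (ξ 1)) lam).toNNReal).map (id : ℝ → ℝ)) u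
      = ((Real.exp (-(u ^ 2 * limitVariance f (rvLaplace P (ξ 1)) lam / 2)) : ℝ) : ℂ) := by
    rw [Measure.map_id, charFun_gaussianReal, Complex.ofReal_exp]
    congr 1
    have : (((limitVariance f (rvLaplace P (ξ 1)) lam).toNNReal : ℝ) : ℂ)
        = (limitVariance f (rvLaplace P (ξ 1)) lam : ℂ) := by rw [Real.coe_toNNReal _ hV0]
    rw [this]
    push_cast
    ring
  simp only [ProbabilityMeasure.coe_mk]
  rw [hgauss]
  refine key.congr fun N => ?_
  rw [charFun_apply_real, integral_map (hSm N).aemeasurable (by fun_prop)]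
  push_cast
  rfl
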